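/- **Setting.** For a dyadic interval $I\subseteq[0,1)$ let $I_-,I_+$ be its left and right halves, $h_I=|I|^{-1/2}(\mathbf 1_{I_+}-\mathbf 1_{I_-})$, and let $\mathcal D_{\rm odd}$ be the set of dyadic $I\subseteq[0,1)$ with $|I|=2^{-k}$, $k$ odd. For $f:\mathbb R\to\mathbb R^2$ write $(f,h_I)=\int f\,h_I\,dx\in\mathbb R^2$ and $$\mathbb S f=\sum_{I\in\mathcal D_{\rm odd}}(f,h_I)\,[h_{I_+}-h_{I_-}],\qquad \mathbb S_0f=\sum_{I\in\mathcal D_{\rm odd}}\big[(f,h_{I_+})h_{I_-}-(f,h_{I_-})h_{I_+}\big],$$ $\mathbb S^*f=\sum_{I\in\mathcal D_{\rm odd}}(f,h_{I_+}-h_{I_-})\,h_I$ (the adjoint of $\mathbb S$ in the unweighted $L^2$), and $\mathcal H^{\rm dy}=c_1(\mathbb S-\mathbb S^*)+c_2\mathbb S_0$ with $c_1,c_2\in\mathbb R$. For a $2\times2$ matrix weight $W$ on $[0,1)$, $\|f\|_{L^2(W)}^2=\int_0^1(W f,f)_{\mathbb R^2}\,dx$. **The weight.** Let $q=1/10$,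 $Q$ large, $r=2-1/Q$, $\alpha_0,\beta_0>0$, $\delta_0=q(\beta_0/\alpha_0)^{1/2}$, let $\mathbf a_0,\mathbf b_0$ be an orthonormal basis of $\mathbb R^2$, and let $N\in\mathbb N$. Put $\alpha_0^\#=Q/\beta_0$, $\beta_0^\#=Q/\alpha_0$ and, recursively, $\delta_n=q(\beta_n/\alpha_n)^{1/2}$, $$\tilde\alpha_n=\tfrac{\alpha_n-\delta_n^2\beta_n}{1-\delta_n^2},\quad \tilde\beta_n=\tfrac{\beta_n-\delta_n^2\alpha_n}{1-\delta_n^2},\quad \tilde\alpha_n^\#=\tfrac{\alpha_n^\#-\delta_n^2\beta_n^\#}{1-\delta_n^2},\quad \tilde\beta_n^\#=\tfrac{\beta_n^\#-\delta_n^2\alpha_n^\#}{1-\delta_n^2},\quad s_n=\tilde\alpha_n\tilde\beta_n^\#/Q,$$ $$\alpha_{n+1}=r\tilde\alpha_n,\quad \beta_{n+1}=\tilde\beta_n/(s_nr),\quad \alpha_{n+1}^\#=r\tilde\alpha_n^\#,\quad \beta_{n+1}^\#=\tilde\beta_n^\#/(s_nr).$$ The averages of $W^{-1}$ and $W$ over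 dyadic intervals are prescribed in the form $\langle W^{-1}\rangle=\alpha\,\mathbf a\mathbf a^*+\beta\,\mathbf b\mathbf b^*$, $\langle W\rangle=\beta^\#\mathbf a\mathbf a^*+\alpha^\#\mathbf b\mathbf b^*$ as follows. The only stopping interval of generation $0$ is $[0,1)$, with basis $\mathbf a_0,\mathbf b_0$. A stopping interval $I$ of generation $n$, with basis $\mathbf a_I,\mathbf b_I$, has eigenvalues $\alpha_n,\beta_n,\alpha_n^\#,\beta_n^\#$. If $n<N$, its halves $I_\pm$ have eigenvalues $\tilde\alpha_n,\tilde\beta_n,\tilde\alpha_n^\#,\tilde\beta_n^\#$ and bases $$\mathbf a_{I_\pm}=(1+\delta_n^2)^{-1/2}(\mathbf a_I\pm\delta_n\mathbf b_I),\qquad \mathbf b_{I_\pm}=(1+\delta_n^2)^{-1/2}(\mathbf b_I\mp\delta_n\mathbf a_I).$$ For $J=I_\pm$, the right half $J_+$ is a stopping interval of generation $n+1$ with basis $\mathbf a_J,\mathbf b_J$, and the left half $J_-$ is terminal, with the same basis and eigenvalues $$(2-r)\tilde\alpha_n,\quad \big(2-\tfrac1{s_nr}\big)\tilde\beta_n,\quad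 (2-r)\tilde\alpha_n^\#,\quad \big(2-\tfrac1{s_nr}\big)\tilde\beta_n^\#$$ for $\alpha,\beta,\alpha^\#,\beta^\#$ respectively. Finally, let $K$ be a terminal interval or a stopping interval of generation $N$, with basis $\mathbf a,\mathbf b$ and eigenvalues $\alpha,\beta,\alpha^\#,\beta^\#$. On its halves $K_\pm$ the weight is constant: $$W=\beta^\#\Big(1\pm\sqrt{1-\tfrac1{\alpha\beta^\#}}\Big)\mathbf a\mathbf a^*+\alpha^\#\Big(1\pm\sqrt{1-\tfrac1{\alpha^\#\beta}}\Big)\mathbf b\mathbf b^* .$$ This defines the weight $W=W_{Q,\alpha_0,\beta_0,\mathbf a_0,\mathbf b_0,N}$ on $[0,1)$. **Statement.** For an operator $T$ consider the following assertion. $(\ast)$ There are $c>0$ and $Q_0$ such that for every $Q\ge Q_0$ there is $\delta_*>0$ such that for all $\alpha_0,\beta_0>0$ with $\delta_0=q(\beta_0/\alpha_0)^{1/2}\le\delta_*$ there is $N_0$ such that for all $N\ge N_0$, all orthonormal bases $\mathbf a_0,\mathbf b_0$ and $e\in\{\mathbf a_0,\ \mathbf a_0+\mathbf b_0\}$, the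 weight $W$ above and $f=W^{-1}\mathbf 1_{[0,1)}e$ satisfy $$\|Tf\|_{L^2(W)}\ \ge\ c\,Q^{3/2}\,\|f\|_{L^2(W)} .$$ Then: 1. for all real $c_1\ne0$ and $c_2$, $(\ast)$ holds for $T=\mathcal H^{\rm dy}=c_1(\mathbb S-\mathbb S^*)+c_2\mathbb S_0$ (with $c,Q_0,\delta_*,N_0$ allowed to depend on $c_1,c_2$); 2. $(\ast)$ holds for the odd Haar shift $T=\mathbb S$. -/

import Mathlib

open MeasureTheory
open scoped Matrix

noncomputable section

namespace DyadicModel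

/-! ### Dyadic intervals of `[0,1)` and Haar functions

The dyadic interval of generation `k` and position `j < 2 ^ k` is `[j 2⁻ᵏ, (j+1) 2⁻ᵏ)`.  Its left
child `I₋` is `(k+1, 2j)`, its right child `I₊` is `(k+1, 2j+1)`. -/

/-- The dyadic interval `[j 2⁻ᵏ, (j+1) 2⁻ᵏ)`. -/
def dyadic (k j : ℕ) : Set ℝ := Set.Ico ((j : ℝ) / 2 ^ k) (((j : ℝ) + 1) / 2 ^ k)

/-- The `L²`-normalized Haar function `h_I = |I|^{-1/2} (1_{I₊} - 1_{I₋})`, where `|I| = 2⁻ᵏ`. -/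
def haar (k j : ℕ) (x : ℝ) : ℝ :=
  √((2 : ℝ) ^ k) *
    ((dyadic (k + 1) (2 * j + 1)).indicator 1 x - (dyadic (k + 1) (2 * j)).indicator 1 x)

/-- The vector `(f, h_I)_{L²} = ∫ h_I f`. -/
def haarCoeff (f : ℝ → Fin 2 → ℝ) (k j : ℕ) : Fin 2 → ℝ := ∫ x, haar k j x • f x

/-! ### Odd Haar shifts

All sums run over the dyadic intervals `I ⊆ [0,1)` of odd generation `2m+1`; for a function with a
finite Haar expansion only finitely many terms are nonzero. -/

/-- Odd Haar shift: `𝕊 f = ∑_I (f, h_I) [h_{I₊} - h_{I₋}]`. -/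
def oddShift (f : ℝ → Fin 2 → ℝ) (x : ℝ) : Fin 2 → ℝ :=
  ∑' m : ℕ, ∑ j ∈ Finset.range (2 ^ (2 * m + 1)),
    (haar (2 * m + 2) (2 * j + 1) x - haar (2 * m + 2) (2 * j) x) • haarCoeff f (2 * m + 1) j

/-- The adjoint in the unweighted `L²`: `𝕊* f = ∑_I (f, h_{I₊} - h_{I₋}) h_I`. -/
def oddShiftAdj (f : ℝ → Fin 2 → ℝ) (x : ℝ) : Fin 2 → ℝ :=
  ∑' m : ℕ, ∑ j ∈ Finset.range (2 ^ (2 * m + 1)),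
    haar (2 * m + 1) j x •
      (haarCoeff f (2 * m + 2) (2 * j + 1) - haarCoeff f (2 * m + 2) (2 * j))

/-- `𝕊₀ f = ∑_I [(f, h_{I₊}) h_{I₋} - (f, h_{I₋}) h_{I₊}]`. -/
def oddShiftZero (f : ℝ → Fin 2 → ℝ) (x : ℝ) : Fin 2 → ℝ :=
  ∑' m : ℕ, ∑ j ∈ Finset.range (2 ^ (2 * m + 1)),
    (haar (2 * m + 2) (2 * j) x • haarCoeff f (2 * m + 2) (2 * j + 1) -
      haar (2 * m + 2) (2 * j + 1) x • haarCoeff f (2 * m + 2) (2 * j))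

/-- The dyadic model operator `c₁ (𝕊 - 𝕊*) + c₂ 𝕊₀`. -/
def modelOp (c₁ c₂ : ℝ) (f : ℝ → Fin 2 → ℝ) (x : ℝ) : Fin 2 → ℝ :=
  c₁ • (oddShift f x - oddShiftAdj f x) + c₂ • oddShiftZero f x

/-- The norm of `L²(W)` for a `2 × 2` matrix weight on `[0,1)`. -/
def weightedNorm (W : ℝ → Matrix (Fin 2) (Fin 2) ℝ) (f : ℝ → Fin 2 → ℝ) : ENNReal :=
  (∫⁻ x in Set.Ico (0 : ℝ) 1, ENNReal.ofReal ((W x *ᵥ f x) ⬝ᵥ f x)) ^ (1 / 2 : ℝ)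

/-! ### The weight: eigenvalues

The averages of `W⁻¹` and `W` over a dyadic interval are tracked in the form
`⟨W⁻¹⟩ = α a a* + β b b*` and `⟨W⟩ = β♯ a a* + α♯ b b*`, with an orthonormal basis `a, b`. -/

/-- The four eigenvalues `α, β, α♯, β♯`. -/
structure Eigen where
  al : ℝ
  be : ℝ
  alS : ℝ
  beS : ℝ

/-- Rotation parameter `δ = q (β/α)^{1/2}` with `q = 0.1`. -/
def Eigen.delta (σ : Eigen) : ℝ := (1 / 10) * √(σ.be / σ.al)

/-- Eigenvalues after the rotation. -/
def Eigen.rotate (σ : Eigen) : Eigen where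
  al := (σ.al - σ.delta ^ 2 * σ.be) / (1 - σ.delta ^ 2)
  be := (σ.be - σ.delta ^ 2 * σ.al) / (1 - σ.delta ^ 2)
  alS := (σ.alS - σ.delta ^ 2 * σ.beS) / (1 - σ.delta ^ 2)
  beS := (σ.beS - σ.delta ^ 2 * σ.alS) / (1 - σ.delta ^ 2)

/-- Stretching parameter `r = 2 - 1/Q`. -/
def stretchR (Q : ℝ) : ℝ := 2 - 1 / Q

/-- `s = α β♯ / Q` (applied to rotated eigenvalues). -/
def Eigen.s (Q : ℝ) (σ : Eigen) : ℝ := σ.al * σ.beS / Q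

/-- Stretching, right child: `(x, y) ↦ (r x, y / (s r))` for `(x, y) = (α, β♯), (α♯, β)`. -/
def Eigen.stretchRight (Q : ℝ) (σ : Eigen) : Eigen where
  al := stretchR Q * σ.al
  be := σ.be / (σ.s Q * stretchR Q)
  alS := stretchR Q * σ.alS
  beS := σ.beS / (σ.s Q * stretchR Q)

/-- Stretching, left child: `(x, y) ↦ ((2 - r) x, (2 - 1 / (s r)) y)`. -/
def Eigen.stretchLeft (Q : ℝ) (σ : Eigen) : Eigen where
  al := (2 - stretchR Q) * σ.al
  be := (2 - 1 / (σ.s Q * stretchR Q)) * σ.be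
  alS := (2 - stretchR Q) * σ.alS
  beS := (2 - 1 / (σ.s Q * stretchR Q)) * σ.beS

/-- Eigenvalues on the two children (`ε = 1` right, `ε = -1` left) of an interval on which the
process is terminated.  In the basis normalizing `w = ⟨W⟩` to the identity one has
`W = 1 ± Δ` on the children, with `Δ ≥ 0` and `Δ² = 1 - v⁻¹`, `v = ⟨W⁻¹⟩`; both are diagonal in
the basis `a, b`.  On each child `⟨W⁻¹⟩ = ⟨W⟩⁻¹`. -/
def Eigen.fill (ε : ℝ) (σ : Eigen) : Eigen where
  al := (σ.beS * (1 + ε * √(1 - 1 / (σ.al * σ.beS))))⁻¹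
  be := (σ.alS * (1 + ε * √(1 - 1 / (σ.alS * σ.be))))⁻¹
  alS := σ.alS * (1 + ε * √(1 - 1 / (σ.alS * σ.be)))
  beS := σ.beS * (1 + ε * √(1 - 1 / (σ.al * σ.beS)))

/-- Eigenvalues `α_n, β_n, α_n♯, β_n♯` on the stopping intervals of generation `n`, with
`α₀ β₀♯ = α₀♯ β₀ = Q`. -/
def stopEigen (Q α₀ β₀ : ℝ) : ℕ → Eigen
  | 0 => ⟨α₀, β₀, Q / β₀, Q / α₀⟩
  | n + 1 => (stopEigen Q α₀ β₀ n).rotate.stretchRight Q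

/-! ### The weight: the martingale on the dyadic tree -/

/-- Role of a dyadic interval in the construction. -/
inductive Role where
  /-- stopping interval of generation `n` -/
  | stopping (n : ℕ)
  /-- child of a stopping interval of generation `n` -/
  | rotated (n : ℕ)
  /-- interval on which the process is terminated: left child of a `rotated` interval -/
  | terminal
  /-- interval on which `W` is constant -/
  | const

/-- Data attached to a dyadic interval: its role, and the eigenvalues and the common orthonormal
eigenbasis of the averages of `W⁻¹` and `W`. -/
structure Node where
  role : Role
  eig : Eigen
  a : Fin 2 → ℝ
  b : Fin 2 → ℝ

/-- `⟨W⟩ = β♯ a a* + α♯ b b*`. -/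
def Node.avgW (ν : Node) : Matrix (Fin 2) (Fin 2) ℝ :=
  ν.eig.beS • Matrix.vecMulVec ν.a ν.a + ν.eig.alS • Matrix.vecMulVec ν.b ν.b

/-- The right (`ε = 1`) and left (`ε = -1`) child of an interval.  The stopping intervals of
generation `N` are treated like terminal intervals. -/
def Node.child (Q α₀ β₀ : ℝ) (N : ℕ) (ν : Node) (ε : ℝ) : Node :=
  match ν.role with
  | .stopping n =>
      if n < N then
        { role := .rotated n
          eig := (stopEigen Q α₀ β₀ n).rotate
          a := (√(1 + (stopEigen Q α₀ β₀ n).delta ^ 2))⁻¹ •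
            (ν.a + (ε * (stopEigen Q α₀ β₀ n).delta) • ν.b)
          b := (√(1 + (stopEigen Q α₀ β₀ n).delta ^ 2))⁻¹ •
            (ν.b - (ε * (stopEigen Q α₀ β₀ n).delta) • ν.a) }
      else { ν with role := .const, eig := ν.eig.fill ε }
  | .rotated n =>
      if 0 < ε then { ν with role := .stopping (n + 1), eig := stopEigen Q α₀ β₀ (n + 1) }
      else { ν with role := .terminal, eig := ν.eig.stretchLeft Q }
  | .terminal => { ν with role := .const, eig := ν.eig.fill ε }
  | .const => ν

/-- The node of the dyadic interval of generation `k` and position `j`; the root `[0,1)` is the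
stopping interval of generation `0`. -/
def node (Q α₀ β₀ : ℝ) (a₀ b₀ : Fin 2 → ℝ) (N : ℕ) : ℕ → ℕ → Node
  | 0, _ => ⟨.stopping 0, stopEigen Q α₀ β₀ 0, a₀, b₀⟩
  | k + 1, j => (node Q α₀ β₀ a₀ b₀ N k (j / 2)).child Q α₀ β₀ N (if j % 2 = 1 then 1 else -1)

/-- The weight on `[0,1)`.  From generation `2N+1` on the martingale is stationary. -/
def weight (Q α₀ β₀ : ℝ) (a₀ b₀ : Fin 2 → ℝ) (N : ℕ) (x : ℝ) : Matrix (Fin 2) (Fin 2) ℝ :=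
  (node Q α₀ β₀ a₀ b₀ N (2 * N + 1) ⌊x * 2 ^ (2 * N + 1)⌋₊).avgW

/-- The function `W⁻¹ 1_{[0,1)} e`. -/
def testFun (W : ℝ → Matrix (Fin 2) (Fin 2) ℝ) (e : Fin 2 → ℝ) : ℝ → Fin 2 → ℝ :=
  (Set.Ico (0 : ℝ) 1).indicator fun x => (W x)⁻¹ *ᵥ e

/-- `‖T f‖_{L²(W)} ≳ Q^{3/2} ‖f‖_{L²(W)}` for the constructed weights `W` and `f = W⁻¹ 1_{[0,1)} e`
with `e = a₀` or `e = a₀ + b₀`: the implied constant `c` is absolute, `Q` is sufficiently large,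
`δ₀ = q (β₀/α₀)^{1/2}` is sufficiently small, and the construction is terminated after
sufficiently many steps. -/
def LowerBound (T : (ℝ → Fin 2 → ℝ) → ℝ → Fin 2 → ℝ) : Prop :=
  ∃ c > (0 : ℝ), ∃ Q₀ : ℝ, ∀ Q ≥ Q₀, ∃ δs > (0 : ℝ), ∀ α₀ β₀ : ℝ, 0 < α₀ → 0 < β₀ →
    (1 / 10) * √(β₀ / α₀) ≤ δs → ∃ N₀ : ℕ, ∀ N ≥ N₀, ∀ a₀ b₀ e : Fin 2 → ℝ,
      a₀ ⬝ᵥ a₀ = 1 → b₀ ⬝ᵥ b₀ = 1 → a₀ ⬝ᵥ b₀ = 0 → (e = a₀ ∨ e = a₀ + b₀) →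
        ENNReal.ofReal (c * Q ^ (3 / 2 : ℝ)) *
            weightedNorm (weight Q α₀ β₀ a₀ b₀ N) (testFun (weight Q α₀ β₀ a₀ b₀ N) e) ≤
          weightedNorm (weight Q α₀ β₀ a₀ b₀ N) (T (testFun (weight Q α₀ β₀ a₀ b₀ N) e))

end DyadicModel

end

/-!
The averages of `f = W⁻¹ e` are `α (a · e) a + β (b · e) b` in the eigenbasis `a, b` of the
interval. On the children of a stopping interval of generation `n` the stretching gives `f` a Haar
coefficient of amplitude about `α_n` in the direction `a`. The shift `𝕊` transplants it one
generation down, just before the next rotation by `± arctan δ` turns it into a jump of the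
`b`-component of `T f`; the sign of the jump follows that of the rotation, so the jumps add up to a
drift of size `δ α ~ √(α₀ β₀)`, the product `α_n β_n` being constant. The contribution of `𝕊*` to
the drift has the same sign, that of `𝕊₀` is smaller by a factor `Q`.

Hence the `b`-component of `T f` has average of size `n √(α₀ β₀)` over the terminal intervals
inside the stopping intervals of generation `n`. For `n ≤ Q` the total measure of these intervals
is about `2⁻ⁿ`, while the eigenvalue `α♯` of `W` in the direction `b` is about `2ⁿ / β₀` there, so
by Cauchy-Schwarz they contribute at least a multiple of `α₀ n²` to `‖T f‖²`. Summation over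
`Q / 2 ≤ n ≤ Q` gives `α₀ Q³`, whereas `‖f‖²` is about `α₀`.
-/

noncomputable section

namespace DyadicModel

/-! ### Dyadic intervals and values of Haar functions -/

/-- The position `j` of the dyadic interval `(k, j)` that contains the point `x ≥ 0`. -/
def dyadicIdx (k : ℕ) (x : ℝ) : ℕ := ⌊x * 2 ^ k⌋₊

lemma nonneg_of_mem_dyadic {k j : ℕ} {x : ℝ} (hx : x ∈ dyadic k j) : 0 ≤ x :=
  le_trans (by positivity) hx.1

lemma mem_dyadic_iff {k j : ℕ} {x : ℝ} (hx : 0 ≤ x) : x ∈ dyadic k j ↔ dyadicIdx k x = j := by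
  have hk : (0 : ℝ) < 2 ^ k := by positivity
  rw [dyadicIdx, Nat.floor_eq_iff (by positivity), dyadic, Set.mem_Ico, div_le_iff₀ hk,
    lt_div_iff₀ hk]

lemma dyadicIdx_of_mem {k j : ℕ} {x : ℝ} (hx : x ∈ dyadic k j) : dyadicIdx k x = j :=
  (mem_dyadic_iff (nonneg_of_mem_dyadic hx)).1 hx

lemma dyadicIdx_succ_div_two (k : ℕ) (x : ℝ) : dyadicIdx (k + 1) x / 2 = dyadicIdx k x := by
  rw [dyadicIdx, dyadicIdx, ← Nat.floor_div_ofNat]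
  congr 1
  rw [pow_succ]
  ring

lemma dyadicIdx_lt {x : ℝ} (hx : x ∈ Set.Ico (0 : ℝ) 1) (k : ℕ) : dyadicIdx k x < 2 ^ k := by
  rw [dyadicIdx, Nat.floor_lt (mul_nonneg hx.1 (by positivity))]
  push_cast
  exact mul_lt_of_lt_one_left (by positivity) hx.2

lemma dyadic_zero_zero : dyadic 0 0 = Set.Ico 0 1 := by simp [dyadic]

lemma dyadic_subset {k j : ℕ} (hj : j < 2 ^ k) : dyadic k j ⊆ Set.Ico 0 1 := by
  intro x hx
  refine ⟨nonneg_of_mem_dyadic hx, hx.2.trans_le ?_⟩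
  rw [div_le_one (by positivity)]
  exact_mod_cast hj

lemma disjoint_dyadic (k : ℕ) {i j : ℕ} (hij : i ≠ j) : Disjoint (dyadic k i) (dyadic k j) := by
  rw [Set.disjoint_left]
  intro x hi hj
  exact hij ((dyadicIdx_of_mem hi).symm.trans (dyadicIdx_of_mem hj))

lemma dyadic_union (k j : ℕ) :
    dyadic (k + 1) (2 * j) ∪ dyadic (k + 1) (2 * j + 1) = dyadic k j := by
  ext x
  refine ⟨fun hx => ?_, fun hx => ?_⟩
  · have hx0 : 0 ≤ x := hx.elim nonneg_of_mem_dyadic nonneg_of_mem_dyadic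
    have := dyadicIdx_succ_div_two k x
    rw [Set.mem_union, mem_dyadic_iff hx0, mem_dyadic_iff hx0] at hx
    rw [mem_dyadic_iff hx0]
    omega
  · have hx0 := nonneg_of_mem_dyadic hx
    have := dyadicIdx_succ_div_two k x
    rw [mem_dyadic_iff hx0] at hx
    rw [Set.mem_union, mem_dyadic_iff hx0, mem_dyadic_iff hx0]
    omega

lemma measurableSet_dyadic (k j : ℕ) : MeasurableSet (dyadic k j) := measurableSet_Ico

lemma volume_dyadic (k j : ℕ) : volume (dyadic k j) = ENNReal.ofReal ((2 ^ k)⁻¹) := by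
  rw [dyadic, Real.volume_Ico]
  congr 1
  ring

lemma lintegral_dyadic_add (φ : ℝ → ENNReal) (k j : ℕ) :
    ∫⁻ x in dyadic k j, φ x =
      (∫⁻ x in dyadic (k + 1) (2 * j), φ x) + ∫⁻ x in dyadic (k + 1) (2 * j + 1), φ x := by
  rw [← dyadic_union k j,
    lintegral_union (measurableSet_dyadic _ _) (disjoint_dyadic _ (by omega))]

lemma lintegral_dyadic_of_eqOn {φ : ℝ → ENNReal} {k j : ℕ} {v : ENNReal}
    (h : ∀ x ∈ dyadic k j, φ x = v) :
    ∫⁻ x in dyadic k j, φ x = v * ENNReal.ofReal ((2 ^ k)⁻¹) := by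
  rw [setLIntegral_congr_fun (measurableSet_dyadic k j) h, setLIntegral_const, volume_dyadic]

/-- The sign of the Haar function of the parent on the interval in position `j`: `1` for odd
positions (right children) and `-1` for even positions (left children). -/
def sgn (j : ℕ) : ℝ := if j % 2 = 1 then 1 else -1

@[simp] lemma sgn_two_mul (j : ℕ) : sgn (2 * j) = -1 := if_neg (by omega)

@[simp] lemma sgn_two_mul_add_one (j : ℕ) : sgn (2 * j + 1) = 1 := if_pos (by omega)

lemma haar_apply (k j : ℕ) {x : ℝ} (hx : 0 ≤ x) :
    haar k j x = if dyadicIdx k x = j then √(2 ^ k) * sgn (dyadicIdx (k + 1) x) else 0 := by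
  have h := dyadicIdx_succ_div_two k x
  classical
  simp only [haar, sgn, Set.indicator_apply, mem_dyadic_iff hx, Pi.one_apply]
  split_ifs <;> first | omega | simp

lemma haar_dyadicIdx (k : ℕ) {x : ℝ} (hx : 0 ≤ x) :
    haar k (dyadicIdx k x) x = √(2 ^ k) * sgn (dyadicIdx (k + 1) x) := by
  rw [haar_apply _ _ hx, if_pos rfl]

lemma haar_of_ne {k j : ℕ} {x : ℝ} (hx : 0 ≤ x) (hj : dyadicIdx k x ≠ j) : haar k j x = 0 := by
  rw [haar_apply _ _ hx, if_neg hj]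

/-- The other child of the parent. -/
def sibling (j : ℕ) : ℕ := if j % 2 = 1 then j - 1 else j + 1

@[simp] lemma sibling_two_mul (j : ℕ) : sibling (2 * j) = 2 * j + 1 := if_neg (by omega)

@[simp] lemma sibling_two_mul_add_one (j : ℕ) : sibling (2 * j + 1) = 2 * j := if_pos (by omega)

lemma sibling_div_two (j : ℕ) : sibling j / 2 = j / 2 := by
  rw [sibling]; split_ifs <;> omega

/-! ### Haar coefficients and averages -/

section

variable {E : Type*} [NormedAddCommGroup E] [NormedSpace ℝ E]

/-- The vectors `m k j` are the averages of `f` over the dyadic subintervals `(k, j)` of `[0,1)`. -/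
structure HasDyadicAverages (f : ℝ → E) (m : ℕ → ℕ → E) : Prop where
  integrableOn {k j : ℕ} (hj : j < 2 ^ k) : IntegrableOn f (dyadic k j)
  setIntegral_eq {k j : ℕ} (hj : j < 2 ^ k) : ∫ x in dyadic k j, f x = ((2 : ℝ) ^ k)⁻¹ • m k j

lemma HasDyadicAverages.of_eqOn_dyadic [CompleteSpace E] {f : ℝ → E} {m : ℕ → ℕ → E} (K : ℕ)
    (hm : ∀ k j, m (k + 1) (2 * j) + m (k + 1) (2 * j + 1) = (2 : ℝ) • m k j)
    (hf : ∀ k j, K ≤ k → j < 2 ^ k → ∀ x ∈ dyadic k j, f x = m k j) : HasDyadicAverages f m := by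
  suffices h : ∀ d k j, K ≤ k + d → j < 2 ^ k → IntegrableOn f (dyadic k j) ∧
      ∫ x in dyadic k j, f x = ((2 : ℝ) ^ k)⁻¹ • m k j from
    ⟨fun hj => (h K _ _ (by omega) hj).1, fun hj => (h K _ _ (by omega) hj).2⟩
  intro d
  induction d with
  | zero =>
    intro k j hk hj
    have heq : Set.EqOn f (fun _ => m k j) (dyadic k j) := hf k j hk hj
    have hfin : volume (dyadic k j) ≠ ⊤ := by rw [volume_dyadic]; exact ENNReal.ofReal_ne_top
    refine ⟨(integrableOn_congr_fun heq (measurableSet_dyadic k j)).2 (integrableOn_const hfin), ?_⟩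
    rw [setIntegral_congr_fun (measurableSet_dyadic k j) heq, setIntegral_const, Measure.real,
      volume_dyadic, ENNReal.toReal_ofReal (by positivity)]
  | succ d ih =>
    intro k j hk hj
    obtain ⟨i₁, v₁⟩ := ih (k + 1) (2 * j) (by omega) (by rw [pow_succ]; omega)
    obtain ⟨i₂, v₂⟩ := ih (k + 1) (2 * j + 1) (by omega) (by rw [pow_succ]; omega)
    rw [← dyadic_union k j]
    refine ⟨i₁.union i₂, ?_⟩
    rw [setIntegral_union (disjoint_dyadic _ (by omega)) (measurableSet_dyadic _ _) i₁ i₂, v₁, v₂,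
      ← smul_add, hm, smul_smul]
    congr 1
    rw [pow_succ]
    field_simp

end

/-- The half-difference of the values on the two children. -/
def halfDiff (m : ℕ → ℕ → Fin 2 → ℝ) (k j : ℕ) : Fin 2 → ℝ :=
  (1 / 2 : ℝ) • (m (k + 1) (2 * j + 1) - m (k + 1) (2 * j))

lemma HasDyadicAverages.haarCoeff_eq {f : ℝ → Fin 2 → ℝ} {m : ℕ → ℕ → Fin 2 → ℝ}
    (h : HasDyadicAverages f m) {k j : ℕ} (hj : j < 2 ^ k) :
    haarCoeff f k j = (√(2 ^ k))⁻¹ • halfDiff m k j := by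
  have hl : 2 * j < 2 ^ (k + 1) := by rw [pow_succ]; omega
  have hr : 2 * j + 1 < 2 ^ (k + 1) := by rw [pow_succ]; omega
  have hhaar : ∀ x, haar k j x • f x = √(2 ^ k) • ((dyadic (k + 1) (2 * j + 1)).indicator f x -
      (dyadic (k + 1) (2 * j)).indicator f x) := by
    intro x
    classical
    simp only [haar, Set.indicator_apply, Pi.one_apply, mul_smul, sub_smul, ite_smul, one_smul,
      zero_smul]
  have hcoeff : √((2 : ℝ) ^ k) * ((2 : ℝ) ^ (k + 1))⁻¹ = (√(2 ^ k))⁻¹ * (1 / 2) := by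
    have hk : (2 : ℝ) ^ k = √(2 ^ k) * √(2 ^ k) := (Real.mul_self_sqrt (by positivity)).symm
    have : 0 < √((2 : ℝ) ^ k) := by positivity
    rw [pow_succ]
    nth_rw 2 [hk]
    field_simp
  simp only [haarCoeff, hhaar]
  rw [integral_smul, integral_sub ((h.integrableOn hr).integrable_indicator
      (measurableSet_dyadic _ _)) ((h.integrableOn hl).integrable_indicator
      (measurableSet_dyadic _ _)), integral_indicator (measurableSet_dyadic _ _),
    integral_indicator (measurableSet_dyadic _ _), h.setIntegral_eq hr, h.setIntegral_eq hl,
    ← smul_sub, halfDiff, smul_smul, smul_smul, hcoeff]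

lemma weightedNorm_eq_of_mulVec_eq {W : ℝ → Matrix (Fin 2) (Fin 2) ℝ} {f : ℝ → Fin 2 → ℝ}
    {m : ℕ → ℕ → Fin 2 → ℝ} {e : Fin 2 → ℝ} (hf : HasDyadicAverages f m)
    (hW : ∀ x ∈ Set.Ico (0 : ℝ) 1, W x *ᵥ f x = e)
    (hpos : ∀ x ∈ Set.Ico (0 : ℝ) 1, 0 ≤ (W x *ᵥ f x) ⬝ᵥ f x) :
    weightedNorm W f = ENNReal.ofReal (e ⬝ᵥ m 0 0) ^ (1 / 2 : ℝ) := by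
  have hint : IntegrableOn f (Set.Ico 0 1) := dyadic_zero_zero ▸ hf.integrableOn (by norm_num)
  have havg : ∫ x in Set.Ico (0 : ℝ) 1, f x = m 0 0 := by
    simpa [dyadic_zero_zero] using hf.setIntegral_eq (k := 0) (j := 0) (by norm_num)
  let ℓ : (Fin 2 → ℝ) →L[ℝ] ℝ := (dotProductBilin ℝ ℝ e).toContinuousLinearMap
  have hint' : IntegrableOn (fun x => e ⬝ᵥ f x) (Set.Ico 0 1) := ℓ.integrable_comp hint
  have hnonneg : ∀ x ∈ Set.Ico (0 : ℝ) 1, 0 ≤ e ⬝ᵥ f x := fun x hx => hW x hx ▸ hpos x hx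
  rw [weightedNorm, setLIntegral_congr_fun (g := fun x => ENNReal.ofReal (e ⬝ᵥ f x))
      measurableSet_Ico fun x hx => by rw [hW x hx],
    ← ofReal_integral_eq_lintegral_ofReal hint'
      ((ae_restrict_iff' measurableSet_Ico).2 (.of_forall hnonneg)), ← havg]
  exact congrArg (fun t => ENNReal.ofReal t ^ (1 / 2 : ℝ)) (ℓ.integral_comp_comm hint)

/-! ### The operators on functions with finite Haar expansion -/

/-- The coefficients of the operator `c₁ 𝕊 - c₃ 𝕊* + c₂ 𝕊₀`, which covers both the model operator
(`c₃ = c₁`) and the odd Haar shift (`c₂ = c₃ = 0`). -/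
structure ShiftCoeffs where
  c₁ : ℝ
  c₂ : ℝ
  c₃ : ℝ

/-- The operator `c₁ 𝕊 - c₃ 𝕊* + c₂ 𝕊₀`. -/
def ShiftCoeffs.op (κ : ShiftCoeffs) (f : ℝ → Fin 2 → ℝ) (x : ℝ) : Fin 2 → ℝ :=
  κ.c₁ • oddShift f x - κ.c₃ • oddShiftAdj f x + κ.c₂ • oddShiftZero f x

/-- The Haar coefficient of `κ.op f` at the interval `(k, j)` in terms of the Haar coefficients `d`
of `f`. Coefficients are normalized by `|I|^{1/2}`, that is, they are half-differences of averages
over the two children. -/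
def ShiftCoeffs.incr (κ : ShiftCoeffs) (d : ℕ → ℕ → Fin 2 → ℝ) : ℕ → ℕ → Fin 2 → ℝ
  | 0, _ => 0
  | k + 1, j =>
      if k % 2 = 0 then -((κ.c₃ / √2) • (d (k + 2) (2 * j + 1) - d (k + 2) (2 * j)))
      else sgn j • ((κ.c₁ * √2) • d k (j / 2) - κ.c₂ • d (k + 1) (sibling j))

/-- The sum of the terms of generation less than `k` of the Haar expansion with normalized
coefficients `c`, on the interval `(k, j)`. -/
def partialSum (c : ℕ → ℕ → Fin 2 → ℝ) : ℕ → ℕ → Fin 2 → ℝ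
  | 0, _ => 0
  | k + 1, j => partialSum c k (j / 2) + sgn j • c k (j / 2)

section

variable (κ : ShiftCoeffs) (d : ℕ → ℕ → Fin 2 → ℝ)

lemma ShiftCoeffs.incr_odd (m j : ℕ) : κ.incr d (2 * m + 1) j =
    -((κ.c₃ / √2) • (d (2 * m + 2) (2 * j + 1) - d (2 * m + 2) (2 * j))) :=
  if_pos (by omega)

lemma ShiftCoeffs.incr_even (m j : ℕ) : κ.incr d (2 * m + 2) j =
    sgn j • ((κ.c₁ * √2) • d (2 * m + 1) (j / 2) - κ.c₂ • d (2 * m + 2) (sibling j)) :=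
  if_neg (by omega)

end

lemma partialSum_two_mul (c : ℕ → ℕ → Fin 2 → ℝ) (k j : ℕ) :
    partialSum c (k + 1) (2 * j) = partialSum c k j - c k j := by
  rw [partialSum, sgn_two_mul, Nat.mul_div_cancel_left j two_pos, neg_one_smul, sub_eq_add_neg]

lemma partialSum_two_mul_add_one (c : ℕ → ℕ → Fin 2 → ℝ) (k j : ℕ) :
    partialSum c (k + 1) (2 * j + 1) = partialSum c k j + c k j := by
  rw [partialSum, sgn_two_mul_add_one, show (2 * j + 1) / 2 = j by omega, one_smul]

lemma partialSum_incr_eq_sum (κ : ShiftCoeffs) (d : ℕ → ℕ → Fin 2 → ℝ) (x : ℝ) (M : ℕ) :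
    partialSum (κ.incr d) (2 * M + 1) (dyadicIdx (2 * M + 1) x) = ∑ m ∈ Finset.range M,
      (sgn (dyadicIdx (2 * m + 2) x) • κ.incr d (2 * m + 1) (dyadicIdx (2 * m + 1) x) +
        sgn (dyadicIdx (2 * m + 3) x) • κ.incr d (2 * m + 2) (dyadicIdx (2 * m + 2) x)) := by
  induction M with
  | zero => simp [partialSum, ShiftCoeffs.incr]
  | succ M ih =>
    rw [Finset.sum_range_succ, ← ih, show 2 * (M + 1) + 1 = 2 * M + 1 + 1 + 1 by ring, partialSum,
      dyadicIdx_succ_div_two, partialSum, dyadicIdx_succ_div_two, add_assoc]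

section

variable {f : ℝ → Fin 2 → ℝ} {d : ℕ → ℕ → Fin 2 → ℝ} {x : ℝ}

lemma sqrt_two_pow_succ (k : ℕ) : √((2 : ℝ) ^ (k + 1)) = √2 * √(2 ^ k) := by
  rw [pow_succ', Real.sqrt_mul zero_le_two]

lemma oddShift_summand (hf : ∀ k j, j < 2 ^ k → haarCoeff f k j = (√(2 ^ k))⁻¹ • d k j)
    (hx : x ∈ Set.Ico (0 : ℝ) 1) (k : ℕ) :
    ∑ j ∈ Finset.range (2 ^ k),
      (haar (k + 1) (2 * j + 1) x - haar (k + 1) (2 * j) x) • haarCoeff f k j =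
    (√2 * (sgn (dyadicIdx (k + 1) x) * sgn (dyadicIdx (k + 2) x))) • d k (dyadicIdx k x) := by
  have hpar := dyadicIdx_succ_div_two k x
  have hlt := dyadicIdx_lt hx k
  have : 0 < √((2 : ℝ) ^ k) := by positivity
  rw [Finset.sum_eq_single_of_mem _ (Finset.mem_range.2 hlt), hf _ _ hlt, smul_smul]
  · congr 1
    rw [haar_apply _ _ hx.1, haar_apply _ _ hx.1, sqrt_two_pow_succ]
    rcases Nat.even_or_odd' (dyadicIdx (k + 1) x) with ⟨c, hc | hc⟩
    · rw [← hpar, hc, if_neg (by omega), if_pos (by omega), sgn_two_mul]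
      field_simp
      ring
    · rw [← hpar, hc, if_pos (by omega), if_neg (by omega), sgn_two_mul_add_one]
      field_simp
      ring
  · intro j _ hj
    rw [haar_of_ne hx.1 (by omega), haar_of_ne hx.1 (by omega), sub_zero, zero_smul]

lemma oddShiftAdj_summand (hf : ∀ k j, j < 2 ^ k → haarCoeff f k j = (√(2 ^ k))⁻¹ • d k j)
    (hx : x ∈ Set.Ico (0 : ℝ) 1) (k : ℕ) :
    ∑ j ∈ Finset.range (2 ^ k), haar k j x •
      (haarCoeff f (k + 1) (2 * j + 1) - haarCoeff f (k + 1) (2 * j)) =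
    (sgn (dyadicIdx (k + 1) x) / √2) •
      (d (k + 1) (2 * dyadicIdx k x + 1) - d (k + 1) (2 * dyadicIdx k x)) := by
  have hlt := dyadicIdx_lt hx k
  have : 0 < √((2 : ℝ) ^ k) := by positivity
  have : 2 ^ (k + 1) = 2 * 2 ^ k := pow_succ' 2 k
  rw [Finset.sum_eq_single_of_mem _ (Finset.mem_range.2 hlt), hf _ _ (by omega),
    hf _ _ (by omega), ← smul_sub, smul_smul, haar_dyadicIdx _ hx.1, sqrt_two_pow_succ]
  · congr 1
    field_simp
  · intro j _ hj
    rw [haar_of_ne hx.1 hj.symm, zero_smul]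

lemma oddShiftZero_summand (hf : ∀ k j, j < 2 ^ k → haarCoeff f k j = (√(2 ^ k))⁻¹ • d k j)
    (hx : x ∈ Set.Ico (0 : ℝ) 1) (k : ℕ) :
    ∑ j ∈ Finset.range (2 ^ k),
      (haar (k + 1) (2 * j) x • haarCoeff f (k + 1) (2 * j + 1) -
        haar (k + 1) (2 * j + 1) x • haarCoeff f (k + 1) (2 * j)) =
    -((sgn (dyadicIdx (k + 1) x) * sgn (dyadicIdx (k + 2) x)) •
      d (k + 1) (sibling (dyadicIdx (k + 1) x))) := by
  have hpar := dyadicIdx_succ_div_two k x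
  have hlt := dyadicIdx_lt hx k
  have hpow : √((2 : ℝ) ^ (k + 1)) ≠ 0 := by positivity
  have : 2 ^ (k + 1) = 2 * 2 ^ k := pow_succ' 2 k
  rw [Finset.sum_eq_single_of_mem _ (Finset.mem_range.2 hlt), hf _ _ (by omega),
    hf _ _ (by omega), smul_smul, smul_smul, haar_apply _ _ hx.1, haar_apply _ _ hx.1]
  · rcases Nat.even_or_odd' (dyadicIdx (k + 1) x) with ⟨c, hc | hc⟩
    · rw [← hpar, hc, if_pos (by omega), if_neg (by omega), mul_right_comm, mul_inv_cancel₀ hpow,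
        show 2 * c / 2 = c by omega, sgn_two_mul, sibling_two_mul]
      module
    · rw [← hpar, hc, if_neg (by omega), if_pos (by omega), mul_right_comm, mul_inv_cancel₀ hpow,
        show (2 * c + 1) / 2 = c by omega, sgn_two_mul_add_one, sibling_two_mul_add_one]
      module
  · intro j _ hj
    rw [haar_of_ne hx.1 (by omega), haar_of_ne hx.1 (by omega), zero_smul, zero_smul, sub_zero]

lemma ShiftCoeffs.op_eq_partialSum (κ : ShiftCoeffs) {M : ℕ}
    (hf : ∀ k j, j < 2 ^ k → haarCoeff f k j = (√(2 ^ k))⁻¹ • d k j)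
    (hx : x ∈ Set.Ico (0 : ℝ) 1)
    (hodd : ∀ m, M ≤ m → d (2 * m + 1) (dyadicIdx (2 * m + 1) x) = 0)
    (heven : ∀ m i, M ≤ m → i / 2 = dyadicIdx (2 * m + 1) x → d (2 * m + 2) i = 0) :
    κ.op f x = partialSum (κ.incr d) (2 * M + 1) (dyadicIdx (2 * M + 1) x) := by
  rw [partialSum_incr_eq_sum, op, oddShift, oddShiftAdj, oddShiftZero]
  simp only [oddShift_summand hf hx, oddShiftAdj_summand hf hx, oddShiftZero_summand hf hx]
  rw [tsum_eq_sum (s := Finset.range M), tsum_eq_sum (s := Finset.range M),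
    tsum_eq_sum (s := Finset.range M), Finset.smul_sum, Finset.smul_sum, Finset.smul_sum,
    ← Finset.sum_sub_distrib, ← Finset.sum_add_distrib]
  · refine Finset.sum_congr rfl fun m _ => ?_
    rw [κ.incr_odd, κ.incr_even, dyadicIdx_succ_div_two, div_eq_mul_inv κ.c₃,
      div_eq_mul_inv (sgn _)]
    module
  all_goals
    intro m hm
    rw [Finset.mem_range, not_lt] at hm
  · rw [heven m _ hm (by rw [sibling_div_two, dyadicIdx_succ_div_two]), smul_zero, neg_zero]
  · rw [heven m _ hm (by omega), heven m _ hm (by omega), sub_zero, smul_zero]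
  · rw [hodd m hm, smul_zero]

end

/-! ### Eigenvalues on the stopping intervals -/

lemma three_halves_le_stretchR {Q : ℝ} (hQ : 2 ≤ Q) : 3 / 2 ≤ stretchR Q := by
  have : 1 / Q ≤ 1 / 2 := one_div_le_one_div_of_le two_pos hQ
  rw [stretchR]; linarith

namespace Eigen

/-- Eigenvalues as they occur on the stopping intervals: `α ≥ β > 0`, `α β♯ = α♯ β = Q ≥ 2`. -/
structure Balanced (Q : ℝ) (σ : Eigen) : Prop where
  two_le : 2 ≤ Q
  be_pos : 0 < σ.be
  be_le_al : σ.be ≤ σ.al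
  alS_eq : σ.alS = Q / σ.be
  beS_eq : σ.beS = Q / σ.al

/-- The factor `α̃ / α = α̃♯ / α♯` of the rotation. -/
def factor (σ : Eigen) : ℝ := (1 - (σ.be / σ.al) ^ 2 / 100) / (1 - σ.be / σ.al / 100)

/-- The factor `β̃ / β = β̃♯ / β♯` of the rotation. -/
def cofactor (σ : Eigen) : ℝ := (99 / 100) / (1 - σ.be / σ.al / 100)

/-- The product `α β♯ = α♯ β` on the terminal intervals, see `Balanced.stretchLeft_al_mul_beS`. -/
def terminalProd (Q : ℝ) (σ : Eigen) : ℝ := 2 * (σ.factor * σ.cofactor) - 1 / stretchR Q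

lemma stretchLeft_al (Q : ℝ) (σ : Eigen) : (σ.stretchLeft Q).al = σ.al / Q := by
  simp only [stretchLeft, stretchR]; ring

lemma delta_nonneg (σ : Eigen) : 0 ≤ σ.delta := by unfold delta; positivity

namespace Balanced

variable {Q : ℝ} {σ : Eigen} (h : σ.Balanced Q)

include h

lemma al_pos : 0 < σ.al := h.be_pos.trans_le h.be_le_al

lemma Q_pos : 0 < Q := two_pos.trans_le h.two_le

lemma ratio_pos : 0 < σ.be / σ.al := div_pos h.be_pos h.al_pos

lemma ratio_le_one : σ.be / σ.al ≤ 1 := (div_le_one h.al_pos).2 h.be_le_al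

lemma three_halves_le_stretchR : 3 / 2 ≤ stretchR Q :=
  DyadicModel.three_halves_le_stretchR h.two_le

lemma stretchR_pos : 0 < stretchR Q := by linarith [h.three_halves_le_stretchR]

lemma delta_sq : σ.delta ^ 2 = σ.be / σ.al / 100 := by
  rw [delta, mul_pow, Real.sq_sqrt h.ratio_pos.le]; ring

lemma delta_sq_le : σ.delta ^ 2 ≤ 1 / 100 := by
  rw [h.delta_sq]; linarith [h.ratio_le_one]

lemma al_mul_delta : σ.al * σ.delta = √(σ.al * σ.be) / 10 := by
  have hal := h.al_pos
  have : σ.al * σ.be = σ.al ^ 2 * (σ.be / σ.al) := by field_simp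
  rw [delta, this, Real.sqrt_mul (sq_nonneg _), Real.sqrt_sq hal.le]
  ring

lemma one_le_factor : 1 ≤ σ.factor := by
  have hpos := h.ratio_pos
  have hle := h.ratio_le_one
  rw [factor, le_div_iff₀ (by linarith)]
  nlinarith

lemma factor_le : σ.factor ≤ 100 / 99 := by
  have := h.ratio_pos
  have hle := h.ratio_le_one
  rw [factor, div_le_iff₀ (by linarith)]
  nlinarith

lemma le_cofactor : 99 / 100 ≤ σ.cofactor := by
  have hpos := h.ratio_pos
  have hle := h.ratio_le_one
  rw [cofactor, le_div_iff₀ (by linarith)]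
  linarith

lemma cofactor_le_one : σ.cofactor ≤ 1 := by
  have hle := h.ratio_le_one
  rw [cofactor, div_le_one (by linarith)]
  linarith

lemma factor_pos : 0 < σ.factor := one_pos.trans_le h.one_le_factor

lemma cofactor_pos : 0 < σ.cofactor := by linarith [h.le_cofactor]

lemma le_factor_mul_cofactor : 99 / 100 ≤ σ.factor * σ.cofactor := by
  nlinarith [h.one_le_factor, h.le_cofactor]

lemma rotate_al : σ.rotate.al = σ.factor * σ.al := by
  have := h.al_pos
  simp only [rotate, h.delta_sq, factor]
  rw [div_mul_eq_mul_div]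
  field_simp

lemma rotate_be : σ.rotate.be = σ.cofactor * σ.be := by
  have := h.al_pos
  simp only [rotate, h.delta_sq, cofactor]
  rw [div_mul_eq_mul_div]
  field_simp
  ring

lemma rotate_alS : σ.rotate.alS = σ.factor * σ.alS := by
  have := h.al_pos
  have := h.be_pos
  simp only [rotate, h.delta_sq, factor, h.alS_eq, h.beS_eq]
  rw [div_mul_eq_mul_div]
  field_simp

lemma rotate_beS : σ.rotate.beS = σ.cofactor * σ.beS := by
  have := h.al_pos
  have := h.be_pos
  simp only [rotate, h.delta_sq, cofactor, h.alS_eq, h.beS_eq]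
  rw [div_mul_eq_mul_div]
  field_simp
  ring

lemma rotate_al_pos : 0 < σ.rotate.al := h.rotate_al ▸ mul_pos h.factor_pos h.al_pos

lemma rotate_be_pos : 0 < σ.rotate.be := h.rotate_be ▸ mul_pos h.cofactor_pos h.be_pos

lemma rotate_be_le : σ.rotate.be ≤ σ.be :=
  h.rotate_be ▸ mul_le_of_le_one_left h.be_pos.le h.cofactor_le_one

lemma rotate_be_le_al : σ.rotate.be ≤ σ.rotate.al :=
  h.rotate_be_le.trans <| h.be_le_al.trans <|
    h.rotate_al ▸ le_mul_of_one_le_left h.al_pos.le h.one_le_factor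

lemma rotate_s : σ.rotate.s Q = σ.factor * σ.cofactor := by
  have := h.al_pos
  have := h.Q_pos
  rw [s, h.rotate_al, h.rotate_beS, h.beS_eq]
  field_simp

lemma one_div_s_mul_stretchR_pos : 0 < 1 / (σ.rotate.s Q * stretchR Q) := by
  rw [h.rotate_s]
  exact one_div_pos.2 (mul_pos (mul_pos h.factor_pos h.cofactor_pos) h.stretchR_pos)

lemma one_div_s_mul_stretchR_le : 1 / (σ.rotate.s Q * stretchR Q) ≤ 7 / 10 := by
  rw [h.rotate_s, div_le_iff₀ (by nlinarith [h.le_factor_mul_cofactor, h.stretchR_pos])]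
  nlinarith [h.le_factor_mul_cofactor, h.three_halves_le_stretchR]

lemma next_al : (σ.rotate.stretchRight Q).al = stretchR Q * (σ.factor * σ.al) := by
  rw [stretchRight, h.rotate_al]

lemma next_be : (σ.rotate.stretchRight Q).be = σ.be / (stretchR Q * σ.factor) := by
  have := h.factor_pos
  have := h.cofactor_pos
  have := h.stretchR_pos
  simp only [stretchRight, h.rotate_be, h.rotate_s]
  field_simp

lemma three_halves_le_stretchR_mul_factor : 3 / 2 ≤ stretchR Q * σ.factor := by
  nlinarith [h.one_le_factor, h.three_halves_le_stretchR]

lemma next : (σ.rotate.stretchRight Q).Balanced Q := by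
  have hfac := h.factor_pos
  have hcof := h.cofactor_pos
  have hr := h.stretchR_pos
  have hbe := h.be_pos
  have hal := h.al_pos
  have hrf := h.three_halves_le_stretchR_mul_factor
  refine ⟨h.two_le, ?_, ?_, ?_, ?_⟩
  · rw [h.next_be]
    positivity
  · rw [h.next_al, h.next_be, ← mul_assoc]
    calc σ.be / (stretchR Q * σ.factor) ≤ σ.be := div_le_self hbe.le (by linarith)
      _ ≤ σ.al := h.be_le_al
      _ ≤ stretchR Q * σ.factor * σ.al := le_mul_of_one_le_left hal.le (by linarith)
  · rw [h.next_be]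
    simp only [stretchRight, h.rotate_alS, h.alS_eq]
    field_simp
  · rw [h.next_al]
    simp only [stretchRight, h.rotate_beS, h.beS_eq, h.rotate_s]
    field_simp

lemma next_al_mul_be :
    (σ.rotate.stretchRight Q).al * (σ.rotate.stretchRight Q).be = σ.al * σ.be := by
  have := h.factor_pos
  have := h.stretchR_pos
  rw [h.next_al, h.next_be]
  field_simp

lemma next_ratio_le :
    (σ.rotate.stretchRight Q).be / (σ.rotate.stretchRight Q).al ≤ 4 / 9 * (σ.be / σ.al) := by
  have hrf := h.three_halves_le_stretchR_mul_factor
  rw [h.next_al, h.next_be, ← mul_assoc, div_div,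
    show stretchR Q * σ.factor * (stretchR Q * σ.factor * σ.al) =
      (stretchR Q * σ.factor) ^ 2 * σ.al by ring, ← div_div, div_right_comm,
    div_le_iff₀ (by positivity)]
  have hsq : 9 / 4 ≤ (stretchR Q * σ.factor) ^ 2 := by nlinarith
  linarith [mul_le_mul_of_nonneg_left hsq h.ratio_pos.le]

lemma stretchLeft_alS :
    (σ.rotate.stretchLeft Q).alS = σ.rotate.al / (σ.al * σ.be) := by
  have := h.al_pos
  have := h.be_pos
  have := h.Q_pos
  simp only [stretchLeft, stretchR, h.rotate_alS, h.rotate_al, h.alS_eq]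
  field_simp
  ring

lemma stretchLeft_beS :
    (σ.rotate.stretchLeft Q).beS =
      (2 - 1 / (σ.rotate.s Q * stretchR Q)) * (σ.cofactor * (Q / σ.al)) := by
  rw [← h.beS_eq, ← h.rotate_beS]; rfl

lemma stretchLeft_al_mul_beS :
    (σ.rotate.stretchLeft Q).al * (σ.rotate.stretchLeft Q).beS = σ.terminalProd Q := by
  have := h.factor_pos
  have := h.cofactor_pos
  have := h.stretchR_pos
  have := h.al_pos
  have := h.Q_pos
  rw [stretchLeft_al, h.rotate_al, h.stretchLeft_beS, h.rotate_s, terminalProd]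
  field_simp

lemma stretchLeft_alS_mul_be :
    (σ.rotate.stretchLeft Q).alS * (σ.rotate.stretchLeft Q).be = σ.terminalProd Q := by
  have := h.factor_pos
  have := h.cofactor_pos
  have := h.stretchR_pos
  have := h.al_pos
  have := h.be_pos
  rw [h.stretchLeft_alS, h.rotate_al, terminalProd]
  simp only [stretchLeft, h.rotate_be, h.rotate_s]
  field_simp

lemma one_le_terminalProd : 1 ≤ σ.terminalProd Q := by
  have : 1 / stretchR Q ≤ 1 / (3 / 2) :=
    one_div_le_one_div_of_le (by norm_num) h.three_halves_le_stretchR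
  rw [terminalProd]
  linarith [h.le_factor_mul_cofactor]

end Balanced

/-! ### Vectors `⟨W⁻¹⟩ e` and their half-differences -/

/-- The vector `⟨W⁻¹⟩ e` for `⟨W⁻¹⟩ = α a a* + β b b*`. -/
def invVec (σ : Eigen) (a b e : Fin 2 → ℝ) : Fin 2 → ℝ :=
  (σ.al * (a ⬝ᵥ e)) • a + (σ.be * (b ⬝ᵥ e)) • b

/-- Positive eigenvalues with `α β♯ ≥ 1` and `α♯ β ≥ 1`. -/
structure Fillable (σ : Eigen) : Prop where
  alS_pos : 0 < σ.alS
  beS_pos : 0 < σ.beS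
  one_le_al_mul_beS : 1 ≤ σ.al * σ.beS
  one_le_alS_mul_be : 1 ≤ σ.alS * σ.be

/-- The eigenvalues of a positive matrix `W` and of its inverse: `α β♯ = α♯ β = 1`. -/
structure Saturated (σ : Eigen) : Prop where
  alS_pos : 0 < σ.alS
  beS_pos : 0 < σ.beS
  al_eq : σ.al = σ.beS⁻¹
  be_eq : σ.be = σ.alS⁻¹

lemma Balanced.fillable {Q : ℝ} {σ : Eigen} (h : σ.Balanced Q) : σ.Fillable := by
  have hal := h.al_pos
  have hbe := h.be_pos
  have hQ := h.Q_pos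
  refine ⟨h.alS_eq ▸ by positivity, h.beS_eq ▸ by positivity, ?_, ?_⟩
  · rw [h.beS_eq, mul_div_cancel₀ _ hal.ne']; linarith [h.two_le]
  · rw [h.alS_eq, div_mul_cancel₀ _ hbe.ne']; linarith [h.two_le]

lemma Balanced.fillable_stretchLeft {Q : ℝ} {σ : Eigen} (h : σ.Balanced Q) :
    (σ.rotate.stretchLeft Q).Fillable where
  alS_pos := h.stretchLeft_alS ▸ div_pos h.rotate_al_pos (mul_pos h.al_pos h.be_pos)
  beS_pos := h.stretchLeft_beS ▸ mul_pos (by linarith [h.one_div_s_mul_stretchR_le])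
    (mul_pos h.cofactor_pos (div_pos h.Q_pos h.al_pos))
  one_le_al_mul_beS := h.stretchLeft_al_mul_beS ▸ h.one_le_terminalProd
  one_le_alS_mul_be := h.stretchLeft_alS_mul_be ▸ h.one_le_terminalProd

lemma sqrt_one_sub_one_div_lt_one {v : ℝ} (hv : 0 < v) : √(1 - 1 / v) < 1 :=
  (Real.sqrt_lt' one_pos).2 (by linarith [one_div_pos.2 hv])

lemma inv_mul_one_add_sqrt {A B ε : ℝ} (hAB : 1 ≤ A * B) (hε : ε ^ 2 = 1) :
    (B * (1 + ε * √(1 - 1 / (A * B))))⁻¹ = A * (1 - ε * √(1 - 1 / (A * B))) := by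
  have hpos : 0 < A * B := by linarith
  have hsq := Real.sq_sqrt (sub_nonneg.2 ((div_le_one hpos).2 hAB))
  refine inv_eq_of_mul_eq_one_right ?_
  calc _ = A * B * (1 - ε ^ 2 * √(1 - 1 / (A * B)) ^ 2) := by ring
    _ = 1 := by rw [hε, hsq, one_mul, sub_sub_cancel, mul_one_div_cancel hpos.ne']

namespace Fillable

variable {σ : Eigen} (h : σ.Fillable)

include h

lemma fill_al {ε : ℝ} (hε : ε ^ 2 = 1) :
    (σ.fill ε).al = σ.al * (1 - ε * √(1 - 1 / (σ.al * σ.beS))) :=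
  inv_mul_one_add_sqrt h.one_le_al_mul_beS hε

lemma fill_be {ε : ℝ} (hε : ε ^ 2 = 1) :
    (σ.fill ε).be = σ.be * (1 - ε * √(1 - 1 / (σ.alS * σ.be))) := by
  have := inv_mul_one_add_sqrt (mul_comm σ.alS σ.be ▸ h.one_le_alS_mul_be) hε
  rwa [mul_comm σ.be σ.alS] at this

lemma saturated_fill {ε : ℝ} (hε : |ε| = 1) : (σ.fill ε).Saturated := by
  have hpos : ∀ {v : ℝ}, 1 ≤ v → 0 < 1 + ε * √(1 - 1 / v) := fun {v} hv => by
    have : |ε * √(1 - 1 / v)| < 1 := by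
      rw [abs_mul, hε, one_mul, abs_of_nonneg (Real.sqrt_nonneg _)]
      exact sqrt_one_sub_one_div_lt_one (by linarith)
    linarith [(abs_lt.1 this).1]
  exact ⟨mul_pos h.alS_pos (hpos h.one_le_alS_mul_be), mul_pos h.beS_pos (hpos h.one_le_al_mul_beS),
    rfl, rfl⟩

lemma invVec_fill_add (a b e : Fin 2 → ℝ) :
    (σ.fill (-1)).invVec a b e + (σ.fill 1).invVec a b e = (2 : ℝ) • σ.invVec a b e := by
  simp only [invVec, h.fill_al (show (1 : ℝ) ^ 2 = 1 by norm_num),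
    h.fill_al (show (-1 : ℝ) ^ 2 = 1 by norm_num), h.fill_be (show (1 : ℝ) ^ 2 = 1 by norm_num),
    h.fill_be (show (-1 : ℝ) ^ 2 = 1 by norm_num)]
  module

lemma invVec_fill_sub (a b e : Fin 2 → ℝ) :
    (1 / 2 : ℝ) • ((σ.fill 1).invVec a b e - (σ.fill (-1)).invVec a b e) =
      -((√(1 - 1 / (σ.al * σ.beS)) * σ.al * (a ⬝ᵥ e)) • a +
        (√(1 - 1 / (σ.alS * σ.be)) * σ.be * (b ⬝ᵥ e)) • b) := by
  simp only [invVec, h.fill_al (show (1 : ℝ) ^ 2 = 1 by norm_num),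
    h.fill_al (show (-1 : ℝ) ^ 2 = 1 by norm_num), h.fill_be (show (1 : ℝ) ^ 2 = 1 by norm_num),
    h.fill_be (show (-1 : ℝ) ^ 2 = 1 by norm_num)]
  module

end Fillable

end Eigen

/-! ### Orthonormal bases and their rotations -/

/-- `a, b` is an orthonormal pair of vectors. -/
structure OrthoPair {ι : Type*} [Fintype ι] (a b : ι → ℝ) : Prop where
  aa : a ⬝ᵥ a = 1
  bb : b ⬝ᵥ b = 1
  ab : a ⬝ᵥ b = 0

/-- The cosine `(1 + δ²)^{-1/2}` of the rotation angle `arctan δ`. -/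
def rotCos (δ : ℝ) : ℝ := (√(1 + δ ^ 2))⁻¹

/-- The first vector of the basis `a, b` rotated by the angle `arctan δ`. -/
def rotA {ι : Type*} (δ : ℝ) (a b : ι → ℝ) : ι → ℝ := rotCos δ • (a + δ • b)

/-- The second vector of the basis `a, b` rotated by the angle `arctan δ`. -/
def rotB {ι : Type*} (δ : ℝ) (a b : ι → ℝ) : ι → ℝ := rotCos δ • (b - δ • a)

lemma rotCos_neg (δ : ℝ) : rotCos (-δ) = rotCos δ := by rw [rotCos, rotCos, neg_sq]

lemma rotCos_sq (δ : ℝ) : rotCos δ ^ 2 = 1 / (1 + δ ^ 2) := by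
  rw [rotCos, inv_pow, Real.sq_sqrt (by positivity), one_div]

namespace OrthoPair

section

variable {ι : Type*} [Fintype ι] {a b : ι → ℝ} (h : OrthoPair a b)

include h

lemma ba : b ⬝ᵥ a = 0 := by rw [dotProduct_comm, h.ab]

lemma rotate (δ : ℝ) : OrthoPair (rotA δ a b) (rotB δ a b) := by
  have hc : rotCos δ ^ 2 * (1 + δ ^ 2) = 1 := by
    rw [rotCos_sq]
    exact one_div_mul_cancel (by positivity)
  constructor <;>
    simp only [rotA, rotB, smul_dotProduct, dotProduct_smul, add_dotProduct, dotProduct_add,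
      sub_dotProduct, dotProduct_sub, smul_eq_mul, h.aa, h.bb, h.ab, h.ba]
  · linear_combination hc
  · linear_combination hc
  · ring

end

lemma vecMulVec_add_vecMulVec {a b : Fin 2 → ℝ} (h : OrthoPair a b) :
    Matrix.vecMulVec a a + Matrix.vecMulVec b b = 1 := by
  have hrows : Matrix.of ![a, b] * (Matrix.of ![a, b])ᵀ = 1 := by
    ext i j
    change ![a, b] i ⬝ᵥ ![a, b] j = _
    fin_cases i <;> fin_cases j <;> simp [h.aa, h.bb, h.ab, h.ba]
  rw [← mul_eq_one_comm.1 hrows]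
  ext i j
  simp [Matrix.vecMulVec_apply, Matrix.mul_apply]

end OrthoPair

namespace Eigen

lemma invVec_rotate_add {σ : Eigen} (hσ : σ.delta ^ 2 ≠ 1) (a b e : Fin 2 → ℝ) :
    σ.rotate.invVec (rotA (-σ.delta) a b) (rotB (-σ.delta) a b) e +
      σ.rotate.invVec (rotA σ.delta a b) (rotB σ.delta a b) e = (2 : ℝ) • σ.invVec a b e := by
  have hne : 1 - σ.delta ^ 2 ≠ 0 := sub_ne_zero.2 hσ.symm
  have hal : rotCos σ.delta ^ 2 * (σ.rotate.al + σ.delta ^ 2 * σ.rotate.be) = σ.al := by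
    rw [rotCos_sq, rotate]; field_simp; ring
  have hbe : rotCos σ.delta ^ 2 * (σ.rotate.be + σ.delta ^ 2 * σ.rotate.al) = σ.be := by
    rw [rotCos_sq, rotate]; field_simp; ring
  simp only [invVec, rotA, rotB, rotCos_neg, smul_dotProduct, add_dotProduct, sub_dotProduct,
    smul_eq_mul]
  rw [← hal, ← hbe]
  module

lemma invVec_rotate_sub (σ : Eigen) (a b e : Fin 2 → ℝ) :
    (1 / 2 : ℝ) • (σ.rotate.invVec (rotA σ.delta a b) (rotB σ.delta a b) e -
      σ.rotate.invVec (rotA (-σ.delta) a b) (rotB (-σ.delta) a b) e) =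
    (σ.delta / (1 + σ.delta ^ 2) * (σ.rotate.al - σ.rotate.be)) •
      ((b ⬝ᵥ e) • a + (a ⬝ᵥ e) • b) := by
  simp only [invVec, rotA, rotB, rotCos_neg, smul_dotProduct, add_dotProduct, sub_dotProduct,
    smul_eq_mul]
  rw [div_eq_mul_one_div σ.delta, ← rotCos_sq]
  module

lemma invVec_stretch_add (Q : ℝ) (σ : Eigen) (a b e : Fin 2 → ℝ) :
    (σ.stretchLeft Q).invVec a b e + (σ.stretchRight Q).invVec a b e =
      (2 : ℝ) • σ.invVec a b e := by
  simp only [invVec, stretchLeft, stretchRight, div_eq_mul_one_div σ.be]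
  module

lemma invVec_stretch_sub (Q : ℝ) (σ : Eigen) (a b e : Fin 2 → ℝ) :
    (1 / 2 : ℝ) • ((σ.stretchRight Q).invVec a b e - (σ.stretchLeft Q).invVec a b e) =
      ((stretchR Q - 1) * σ.al * (a ⬝ᵥ e)) • a +
        ((1 / (σ.s Q * stretchR Q) - 1) * σ.be * (b ⬝ᵥ e)) • b := by
  simp only [invVec, stretchLeft, stretchRight, div_eq_mul_one_div σ.be]
  module

end Eigen

/-! ### The tree of nodes -/

lemma avgW_mulVec_dotProduct (ν : Node) (g : Fin 2 → ℝ) :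
    (ν.avgW *ᵥ g) ⬝ᵥ g = ν.eig.beS * (ν.a ⬝ᵥ g) ^ 2 + ν.eig.alS * (ν.b ⬝ᵥ g) ^ 2 := by
  simp only [Node.avgW, Matrix.add_mulVec, Matrix.smul_mulVec, Matrix.vecMulVec_mulVec,
    add_dotProduct, smul_dotProduct, smul_eq_mul, op_smul_eq_smul]
  ring

section

variable {ν : Node} (ho : OrthoPair ν.a ν.b) (hs : ν.eig.Saturated) (e : Fin 2 → ℝ)

include ho hs

lemma avgW_mulVec_invVec : ν.avgW *ᵥ ν.eig.invVec ν.a ν.b e = e := by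
  have hal := mul_inv_cancel₀ hs.beS_pos.ne'
  have hbe := mul_inv_cancel₀ hs.alS_pos.ne'
  have hI : (ν.a ⬝ᵥ e) • ν.a + (ν.b ⬝ᵥ e) • ν.b = e := by
    simpa only [Matrix.add_mulVec, Matrix.vecMulVec_mulVec, op_smul_eq_smul, Matrix.one_mulVec]
      using congrArg (· *ᵥ e) ho.vecMulVec_add_vecMulVec
  simp only [Node.avgW, Eigen.invVec, Matrix.add_mulVec, Matrix.smul_mulVec,
    Matrix.vecMulVec_mulVec, op_smul_eq_smul, dotProduct_add, dotProduct_smul, smul_eq_mul, ho.aa,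
    ho.bb, ho.ab, ho.ba, mul_zero, mul_one, add_zero, zero_add, smul_smul, hs.al_eq, hs.be_eq,
    ← mul_assoc, hal, hbe, one_mul, hI]

lemma isUnit_det_avgW : IsUnit ν.avgW.det := by
  refine (Matrix.isUnit_iff_isUnit_det _).1 ?_
  rw [← Matrix.mulVec_surjective_iff_isUnit]
  exact fun e => ⟨_, avgW_mulVec_invVec ho hs e⟩

lemma avgW_inv_mulVec : ν.avgW⁻¹ *ᵥ e = ν.eig.invVec ν.a ν.b e := by
  nth_rw 1 [← avgW_mulVec_invVec ho hs e]
  rw [Matrix.mulVec_mulVec, Matrix.nonsing_inv_mul _ (isUnit_det_avgW ho hs), Matrix.one_mulVec]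

end

/-- Admissible parameters `Q, α₀, β₀, a₀, b₀, N` of the construction of the weight. -/
structure Params where
  Q : ℝ
  α₀ : ℝ
  β₀ : ℝ
  a₀ : Fin 2 → ℝ
  b₀ : Fin 2 → ℝ
  N : ℕ
  two_le_Q : 2 ≤ Q
  β₀_pos : 0 < β₀
  β₀_le_α₀ : β₀ ≤ α₀
  ortho : OrthoPair a₀ b₀

namespace Params

variable (P : Params)

/-- The eigenvalues `α_n, β_n, α_n♯, β_n♯` on the stopping intervals of generation `n`. -/
def eig (n : ℕ) : Eigen := stopEigen P.Q P.α₀ P.β₀ n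

/-- The node of the dyadic interval `(k, j)`. -/
def node (k j : ℕ) : Node := DyadicModel.node P.Q P.α₀ P.β₀ P.a₀ P.b₀ P.N k j

/-- The weight `W`. -/
def weight : ℝ → Matrix (Fin 2) (Fin 2) ℝ := DyadicModel.weight P.Q P.α₀ P.β₀ P.a₀ P.b₀ P.N

/-- The average `⟨W⁻¹ e⟩` over the dyadic interval `(k, j)`. -/
def avg (e : Fin 2 → ℝ) (k j : ℕ) : Fin 2 → ℝ :=
  (P.node k j).eig.invVec (P.node k j).a (P.node k j).b e

/-- The normalized Haar coefficient of `W⁻¹ e` at the dyadic interval `(k, j)`. -/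
def diff (e : Fin 2 → ℝ) : ℕ → ℕ → Fin 2 → ℝ := halfDiff (P.avg e)

lemma α₀_pos : 0 < P.α₀ := P.β₀_pos.trans_le P.β₀_le_α₀

lemma Q_pos : 0 < P.Q := two_pos.trans_le P.two_le_Q

lemma balanced_eig (n : ℕ) : (P.eig n).Balanced P.Q := by
  induction n with
  | zero => exact ⟨P.two_le_Q, P.β₀_pos, P.β₀_le_α₀, rfl, rfl⟩
  | succ n ih => exact ih.next

lemma eig_al_mul_be (n : ℕ) : (P.eig n).al * (P.eig n).be = P.α₀ * P.β₀ := by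
  induction n with
  | zero => rfl
  | succ n ih => exact (P.balanced_eig n).next_al_mul_be.trans ih

lemma eig_ratio_le (n : ℕ) : (P.eig n).be / (P.eig n).al ≤ (4 / 9) ^ n := by
  induction n with
  | zero => simpa using (P.balanced_eig 0).ratio_le_one
  | succ n ih =>
    refine (P.balanced_eig n).next_ratio_le.trans ?_
    rw [pow_succ']; gcongr

lemma le_eig_al (n : ℕ) : stretchR P.Q ^ n * P.α₀ ≤ (P.eig n).al := by
  induction n with
  | zero => rw [pow_zero, one_mul]; rfl
  | succ n ih =>
    have h := P.balanced_eig n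
    calc stretchR P.Q ^ (n + 1) * P.α₀ = stretchR P.Q * (stretchR P.Q ^ n * P.α₀) := by ring
      _ ≤ stretchR P.Q * ((P.eig n).factor * (P.eig n).al) := by
        refine mul_le_mul_of_nonneg_left (ih.trans ?_) h.stretchR_pos.le
        exact le_mul_of_one_le_left h.al_pos.le h.one_le_factor
      _ = (P.eig (n + 1)).al := h.next_al.symm

/-! ### Children of the nodes of the tree -/

section

variable {P} {k j n : ℕ}

/-- The children of the node of `(k, j)`, with `ε = 1` for the right and `ε = -1` for the left
one. -/
abbrev child (P : Params) (k j : ℕ) (ε : ℝ) : Node :=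
  (P.node k j).child P.Q P.α₀ P.β₀ P.N ε

lemma node_two_mul (k j : ℕ) : P.node (k + 1) (2 * j) = P.child k j (-1) := by
  rw [node, DyadicModel.node, if_neg (by omega), show 2 * j / 2 = j by omega, child, node]

lemma node_two_mul_add_one (k j : ℕ) : P.node (k + 1) (2 * j + 1) = P.child k j 1 := by
  rw [node, DyadicModel.node, if_pos (by omega), show (2 * j + 1) / 2 = j by omega, child, node]

lemma child_of_stopping (h : (P.node k j).role = .stopping n) (hn : n < P.N) {ε : ℝ}
    (hε : ε ^ 2 = 1) :
    P.child k j ε = ⟨.rotated n, (P.eig n).rotate,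
      rotA (ε * (P.eig n).delta) (P.node k j).a (P.node k j).b,
      rotB (ε * (P.eig n).delta) (P.node k j).a (P.node k j).b⟩ := by
  simp only [child, Node.child, h, if_pos hn, rotA, rotB, rotCos, mul_pow, hε, one_mul, eig]

lemma child_of_stopping_last (h : (P.node k j).role = .stopping n) (hn : ¬ n < P.N) (ε : ℝ) :
    P.child k j ε = { P.node k j with role := .const, eig := (P.node k j).eig.fill ε } := by
  simp only [child, Node.child, h, if_neg hn]

lemma child_of_rotated_right (h : (P.node k j).role = .rotated n) :
    P.child k j 1 = { P.node k j with role := .stopping (n + 1), eig := P.eig (n + 1) } := by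
  simp only [child, Node.child, h, if_pos one_pos, eig]

lemma child_of_rotated_left (h : (P.node k j).role = .rotated n) :
    P.child k j (-1) =
      { P.node k j with role := .terminal, eig := (P.node k j).eig.stretchLeft P.Q } := by
  simp only [child, Node.child, h, if_neg (show ¬ (0 : ℝ) < -1 by norm_num)]

lemma child_of_terminal (h : (P.node k j).role = .terminal) (ε : ℝ) :
    P.child k j ε = { P.node k j with role := .const, eig := (P.node k j).eig.fill ε } := by
  simp only [child, Node.child, h]

lemma child_of_const (h : (P.node k j).role = .const) (ε : ℝ) : P.child k j ε = P.node k j := by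
  simp only [child, Node.child, h]

variable (P) in
/-- What the role of a node says about its generation `k` and its eigenvalues. -/
def RoleSpec (k : ℕ) : Role → Eigen → Prop
  | .stopping n, σ => k = 2 * n ∧ n ≤ P.N ∧ σ = P.eig n
  | .rotated n, σ => k = 2 * n + 1 ∧ n < P.N ∧ σ = (P.eig n).rotate
  | .terminal, σ => ∃ n < P.N, k = 2 * n + 2 ∧ σ = (P.eig n).rotate.stretchLeft P.Q
  | .const, σ => σ.Saturated

variable (P) in
/-- The properties shared by all nodes of generation `k`. -/
structure Valid (k : ℕ) (ν : Node) : Prop where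
  ortho : OrthoPair ν.a ν.b
  roleSpec : P.RoleSpec k ν.role ν.eig

lemma roleSpec_of_role_eq (hν : P.Valid k (P.node k j)) {r : Role}
    (h : (P.node k j).role = r) : P.RoleSpec k r (P.node k j).eig :=
  h ▸ hν.roleSpec

lemma Valid.child (hν : P.Valid k (P.node k j)) {ε : ℝ} (hε : ε = 1 ∨ ε = -1) :
    P.Valid (k + 1) (P.child k j ε) := by
  have habs : |ε| = 1 := by rcases hε with rfl | rfl <;> norm_num
  cases hr : (P.node k j).role with
  | stopping n =>
    obtain ⟨hk, _, heig⟩ := roleSpec_of_role_eq hν hr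
    by_cases hn : n < P.N
    · rw [child_of_stopping hr hn (by rw [← sq_abs, habs, one_pow])]
      exact ⟨hν.ortho.rotate _, by omega, hn, rfl⟩
    · rw [child_of_stopping_last hr hn, heig]
      exact ⟨hν.ortho, (P.balanced_eig n).fillable.saturated_fill habs⟩
  | rotated n =>
    obtain ⟨hk, hn, heig⟩ := roleSpec_of_role_eq hν hr
    rcases hε with rfl | rfl
    · rw [child_of_rotated_right hr]
      exact ⟨hν.ortho, by omega, hn, rfl⟩
    · rw [child_of_rotated_left hr, heig]
      exact ⟨hν.ortho, n, hn, by omega, rfl⟩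
  | terminal =>
    obtain ⟨n, -, -, heig⟩ := roleSpec_of_role_eq hν hr
    rw [child_of_terminal hr, heig]
    exact ⟨hν.ortho, (P.balanced_eig n).fillable_stretchLeft.saturated_fill habs⟩
  | const =>
    rw [child_of_const hr]
    exact ⟨hν.ortho, hr ▸ roleSpec_of_role_eq hν hr⟩

variable (P) in
lemma valid_node (k j : ℕ) : P.Valid k (P.node k j) := by
  induction k generalizing j with
  | zero => exact ⟨P.ortho, rfl, Nat.zero_le _, rfl⟩
  | succ k ih => exact (ih (j / 2)).child (by split_ifs <;> simp)

variable (P) in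
lemma ortho_node (k j : ℕ) : OrthoPair (P.node k j).a (P.node k j).b := (P.valid_node k j).ortho

lemma roleSpec {r : Role} (h : (P.node k j).role = r) : P.RoleSpec k r (P.node k j).eig :=
  roleSpec_of_role_eq (P.valid_node k j) h

end

end Params

/-! ### The test function -/

namespace Params

variable {P : Params} {k j l n : ℕ} {x : ℝ}

lemma avg_add (P : Params) (e : Fin 2 → ℝ) (k j : ℕ) :
    P.avg e (k + 1) (2 * j) + P.avg e (k + 1) (2 * j + 1) = (2 : ℝ) • P.avg e k j := by
  simp only [avg, node_two_mul, node_two_mul_add_one]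
  cases hr : (P.node k j).role with
  | stopping n =>
    obtain ⟨-, -, heig⟩ := roleSpec hr
    by_cases hn : n < P.N
    · rw [child_of_stopping hr hn (by norm_num), child_of_stopping hr hn (by norm_num), heig,
        neg_one_mul, one_mul]
      exact Eigen.invVec_rotate_add (by linarith [(P.balanced_eig n).delta_sq_le]) _ _ _
    · rw [child_of_stopping_last hr hn, child_of_stopping_last hr hn, heig]
      exact (P.balanced_eig n).fillable.invVec_fill_add _ _ _
  | rotated n =>
    obtain ⟨-, -, heig⟩ := roleSpec hr
    rw [child_of_rotated_left hr, child_of_rotated_right hr, heig]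
    exact Eigen.invVec_stretch_add _ _ _ _ _
  | terminal =>
    obtain ⟨n, -, -, heig⟩ := roleSpec hr
    rw [child_of_terminal hr, child_of_terminal hr, heig]
    exact (P.balanced_eig n).fillable_stretchLeft.invVec_fill_add _ _ _
  | const => rw [child_of_const hr, child_of_const hr, two_smul]

lemma role_eq_const (hk : 2 * P.N < k) (j : ℕ) : (P.node k j).role = .const := by
  cases hr : (P.node k j).role with
  | stopping n => obtain ⟨_, _, -⟩ := roleSpec hr; omega
  | rotated n => obtain ⟨_, _, -⟩ := roleSpec hr; omega
  | terminal => obtain ⟨n, _, _, -⟩ := roleSpec hr; omega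
  | const => rfl

lemma node_eq_of_const (h : (P.node k (j / 2)).role = .const) :
    P.node (k + 1) j = P.node k (j / 2) :=
  child_of_const h _

lemma node_dyadicIdx_eq_of_const (h : (P.node k (dyadicIdx k x)).role = .const) (hkl : k ≤ l) :
    P.node l (dyadicIdx l x) = P.node k (dyadicIdx k x) := by
  induction l, hkl using Nat.le_induction with
  | base => rfl
  | succ l _ ih =>
    rw [← ih, ← dyadicIdx_succ_div_two l x, node_eq_of_const]
    rw [dyadicIdx_succ_div_two, ih, h]

lemma diff_eq_zero_of_const (e : Fin 2 → ℝ) (h : (P.node k j).role = .const) :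
    P.diff e k j = 0 := by
  rw [diff, halfDiff, avg, avg, node_two_mul_add_one, node_two_mul, child_of_const h,
    child_of_const h, sub_self, smul_zero]

lemma weight_eq_of_const (h : (P.node k (dyadicIdx k x)).role = .const) :
    P.weight x = (P.node k (dyadicIdx k x)).avgW := by
  have hN := role_eq_const (lt_add_one (2 * P.N)) (dyadicIdx (2 * P.N + 1) x)
  change (P.node (2 * P.N + 1) (dyadicIdx (2 * P.N + 1) x)).avgW = _
  rw [← node_dyadicIdx_eq_of_const hN (le_max_left _ k),
    ← node_dyadicIdx_eq_of_const h (le_max_right _ _)]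

lemma testFun_eq_avg (e : Fin 2 → ℝ) (hx : x ∈ Set.Ico (0 : ℝ) 1)
    (h : (P.node k (dyadicIdx k x)).role = .const) :
    testFun P.weight e x = P.avg e k (dyadicIdx k x) := by
  rw [testFun, Set.indicator_of_mem hx, weight_eq_of_const h]
  exact avgW_inv_mulVec (P.ortho_node _ _) (roleSpec h) e

lemma weight_mulVec_testFun (e : Fin 2 → ℝ) (hx : x ∈ Set.Ico (0 : ℝ) 1) :
    P.weight x *ᵥ testFun P.weight e x = e := by
  have h := role_eq_const (lt_add_one (2 * P.N)) (dyadicIdx (2 * P.N + 1) x)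
  rw [testFun_eq_avg e hx h, weight_eq_of_const h]
  exact avgW_mulVec_invVec (P.ortho_node _ _) (roleSpec h) e

variable (P) in
lemma hasDyadicAverages_testFun (e : Fin 2 → ℝ) :
    HasDyadicAverages (testFun P.weight e) (P.avg e) := by
  refine .of_eqOn_dyadic (2 * P.N + 1) (P.avg_add e) fun k j hk hj x hx => ?_
  rw [testFun_eq_avg e (dyadic_subset hj hx) (role_eq_const hk _), dyadicIdx_of_mem hx]

variable (P) in
lemma weightedNorm_testFun (e : Fin 2 → ℝ) :
    weightedNorm P.weight (testFun P.weight e) =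
      ENNReal.ofReal (P.α₀ * (P.a₀ ⬝ᵥ e) ^ 2 + P.β₀ * (P.b₀ ⬝ᵥ e) ^ 2) ^ (1 / 2 : ℝ) := by
  rw [weightedNorm_eq_of_mulVec_eq (P.hasDyadicAverages_testFun e)
    (fun x hx => weight_mulVec_testFun e hx)]
  · change ENNReal.ofReal (e ⬝ᵥ (P.eig 0).invVec P.a₀ P.b₀ e) ^ _ = _
    rw [dotProduct_comm, Eigen.invVec, add_dotProduct, smul_dotProduct, smul_dotProduct,
      smul_eq_mul, smul_eq_mul, mul_assoc, mul_assoc, ← sq, ← sq]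
    rfl
  · intro x _
    have h := role_eq_const (lt_add_one (2 * P.N)) (dyadicIdx (2 * P.N + 1) x)
    have hs : Eigen.Saturated _ := roleSpec h
    rw [weight_eq_of_const h, avgW_mulVec_dotProduct]
    have := hs.alS_pos
    have := hs.beS_pos
    positivity

/-- The value of `κ.op (W⁻¹ e)` on the dyadic interval `(k, j)`, when it is constant there. -/
def val (P : Params) (κ : ShiftCoeffs) (e : Fin 2 → ℝ) : ℕ → ℕ → Fin 2 → ℝ :=
  partialSum (κ.incr (P.diff e))

lemma op_testFun_eq_val (κ : ShiftCoeffs) (e : Fin 2 → ℝ) (hj : j < 2 ^ (2 * n + 1))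
    (h : (P.node (2 * n + 1) j).role = .const) (hx : x ∈ dyadic (2 * n + 1) j) :
    κ.op (testFun P.weight e) x = P.val κ e (2 * n + 1) j := by
  obtain rfl := dyadicIdx_of_mem hx
  have hrole (m : ℕ) (hm : n ≤ m) :
      (P.node (2 * m + 1) (dyadicIdx (2 * m + 1) x)).role = .const := by
    rw [node_dyadicIdx_eq_of_const h (by omega), h]
  refine κ.op_eq_partialSum (fun k j hj => (P.hasDyadicAverages_testFun e).haarCoeff_eq hj)
    (dyadic_subset hj hx) (fun m hm => diff_eq_zero_of_const e (hrole m hm))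
    fun m i hm hi => diff_eq_zero_of_const e ?_
  rw [node_eq_of_const (hi ▸ hrole m hm), hi, hrole m hm]

end Params

/-! ### Haar coefficients of the test function and of its image -/

namespace Eigen

/-- The amplitude of the normalized Haar coefficient of `W⁻¹ e` on a stopping interval. -/
def rotAmp (σ : Eigen) : ℝ := σ.delta / (1 + σ.delta ^ 2) * (σ.rotate.al - σ.rotate.be)

/-- The amplitude in the direction `a` of the normalized Haar coefficient of `W⁻¹ e` on the children
of a stopping interval. -/
def stretchAmpA (Q : ℝ) (σ : Eigen) : ℝ := (stretchR Q - 1) * σ.rotate.al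

/-- The amplitude in the direction `b` of the normalized Haar coefficient of `W⁻¹ e` on the children
of a stopping interval. -/
def stretchAmpB (Q : ℝ) (σ : Eigen) : ℝ := (1 / (σ.rotate.s Q * stretchR Q) - 1) * σ.rotate.be

/-- The amplitude in the direction `a` of the normalized Haar coefficient of `W⁻¹ e` on a terminal
interval, up to sign. -/
def fillAmpA (Q : ℝ) (σ : Eigen) : ℝ := √(1 - 1 / σ.terminalProd Q) * (σ.rotate.stretchLeft Q).al

/-- The amplitude in the direction `b` of the normalized Haar coefficient of `W⁻¹ e` on a terminal
interval, up to sign. -/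
def fillAmpB (Q : ℝ) (σ : Eigen) : ℝ := √(1 - 1 / σ.terminalProd Q) * (σ.rotate.stretchLeft Q).be

end Eigen

namespace Params

variable {P : Params} {k j n i : ℕ} {e : Fin 2 → ℝ}

lemma diff_of_stopping (h : (P.node k j).role = .stopping n) (hn : n < P.N) :
    P.diff e k j = (P.eig n).rotAmp •
      (((P.node k j).b ⬝ᵥ e) • (P.node k j).a + ((P.node k j).a ⬝ᵥ e) • (P.node k j).b) := by
  rw [diff, halfDiff, avg, avg, node_two_mul_add_one, node_two_mul,
    child_of_stopping h hn (by norm_num), child_of_stopping h hn (by norm_num), neg_one_mul,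
    one_mul]
  exact Eigen.invVec_rotate_sub _ _ _ _

lemma diff_of_rotated (h : (P.node k j).role = .rotated n) :
    P.diff e k j = ((P.eig n).stretchAmpA P.Q * ((P.node k j).a ⬝ᵥ e)) • (P.node k j).a +
      ((P.eig n).stretchAmpB P.Q * ((P.node k j).b ⬝ᵥ e)) • (P.node k j).b := by
  obtain ⟨-, -, heig⟩ := roleSpec h
  rw [diff, halfDiff, avg, avg, node_two_mul_add_one, node_two_mul, child_of_rotated_right h,
    child_of_rotated_left h, heig]
  exact Eigen.invVec_stretch_sub _ _ _ _ _

lemma diff_of_terminal (h : (P.node k j).role = .terminal)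
    (heig : (P.node k j).eig = (P.eig n).rotate.stretchLeft P.Q) :
    P.diff e k j = -(((P.eig n).fillAmpA P.Q * ((P.node k j).a ⬝ᵥ e)) • (P.node k j).a +
      ((P.eig n).fillAmpB P.Q * ((P.node k j).b ⬝ᵥ e)) • (P.node k j).b) := by
  have hσ := P.balanced_eig n
  rw [diff, halfDiff, avg, avg, node_two_mul_add_one, node_two_mul, child_of_terminal h,
    child_of_terminal h, heig, hσ.fillable_stretchLeft.invVec_fill_sub, hσ.stretchLeft_al_mul_beS,
    hσ.stretchLeft_alS_mul_be]
  rfl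

/-! The intervals `(2n+1, i)` with role `rotated n`: the left child `(2n+2, 2i)` is terminal, and
the right child `(2n+2, 2i+1)` is a stopping interval. -/

section

variable (h : (P.node (2 * n + 1) i).role = .rotated n)

include h

lemma stopping_node : P.node (2 * n + 2) (2 * i + 1) =
    { P.node (2 * n + 1) i with role := .stopping (n + 1), eig := P.eig (n + 1) } := by
  rw [node_two_mul_add_one, child_of_rotated_right h]

lemma terminal_node : P.node (2 * n + 2) (2 * i) =
    { P.node (2 * n + 1) i with
      role := .terminal, eig := (P.eig n).rotate.stretchLeft P.Q } := by
  obtain ⟨-, -, heig⟩ := roleSpec h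
  rw [node_two_mul, child_of_rotated_left h, heig]

lemma const_node : P.node (2 * n + 3) (4 * i + 1) =
    { P.node (2 * n + 1) i with
      role := .const, eig := ((P.eig n).rotate.stretchLeft P.Q).fill 1 } := by
  have ht := terminal_node h
  rw [show 4 * i + 1 = 2 * (2 * i) + 1 by ring, node_two_mul_add_one,
    child_of_terminal (by rw [ht]), ht]

lemma rotated_node_left (hn : n + 1 < P.N) : P.node (2 * n + 3) (4 * i + 2) =
    ⟨.rotated (n + 1), (P.eig (n + 1)).rotate,
      rotA (-(P.eig (n + 1)).delta) (P.node (2 * n + 1) i).a (P.node (2 * n + 1) i).b,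
      rotB (-(P.eig (n + 1)).delta) (P.node (2 * n + 1) i).a (P.node (2 * n + 1) i).b⟩ := by
  have hs := stopping_node h
  rw [show 4 * i + 2 = 2 * (2 * i + 1) by ring, node_two_mul,
    child_of_stopping (by rw [hs]) hn (by norm_num), hs, neg_one_mul]

lemma rotated_node_right (hn : n + 1 < P.N) : P.node (2 * n + 3) (4 * i + 3) =
    ⟨.rotated (n + 1), (P.eig (n + 1)).rotate,
      rotA (P.eig (n + 1)).delta (P.node (2 * n + 1) i).a (P.node (2 * n + 1) i).b,
      rotB (P.eig (n + 1)).delta (P.node (2 * n + 1) i).a (P.node (2 * n + 1) i).b⟩ := by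
  have hs := stopping_node h
  rw [show 4 * i + 3 = 2 * (2 * i + 1) + 1 by ring, node_two_mul_add_one,
    child_of_stopping (by rw [hs]) hn (by norm_num), hs, one_mul]

lemma diff_terminal : P.diff e (2 * n + 2) (2 * i) =
    -(((P.eig n).fillAmpA P.Q * ((P.node (2 * n + 1) i).a ⬝ᵥ e)) • (P.node (2 * n + 1) i).a +
      ((P.eig n).fillAmpB P.Q * ((P.node (2 * n + 1) i).b ⬝ᵥ e)) • (P.node (2 * n + 1) i).b) := by
  have ht := terminal_node h
  rw [diff_of_terminal (by rw [ht]) (by rw [ht]), ht]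

lemma diff_stopping (hn : n + 1 < P.N) : P.diff e (2 * n + 2) (2 * i + 1) =
    (P.eig (n + 1)).rotAmp •
      (((P.node (2 * n + 1) i).b ⬝ᵥ e) • (P.node (2 * n + 1) i).a +
        ((P.node (2 * n + 1) i).a ⬝ᵥ e) • (P.node (2 * n + 1) i).b) := by
  have hs := stopping_node h
  rw [diff_of_stopping (by rw [hs]) hn, hs]

variable (κ : ShiftCoeffs)

lemma b_dotProduct_incr_rotated (hn : n + 1 < P.N) :
    (P.node (2 * n + 1) i).b ⬝ᵥ κ.incr (P.diff e) (2 * n + 1) i =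
      -(κ.c₃ / √2 * ((P.eig (n + 1)).rotAmp * ((P.node (2 * n + 1) i).a ⬝ᵥ e) +
        (P.eig n).fillAmpB P.Q * ((P.node (2 * n + 1) i).b ⬝ᵥ e))) := by
  have ho := P.ortho_node (2 * n + 1) i
  rw [κ.incr_odd, diff_stopping h hn, diff_terminal h]
  simp only [dotProduct_add, dotProduct_smul, dotProduct_neg, dotProduct_sub, smul_eq_mul, ho.bb,
    ho.ba]
  ring

lemma a_dotProduct_incr_stopping :
    (P.node (2 * n + 1) i).a ⬝ᵥ κ.incr (P.diff e) (2 * n + 2) (2 * i + 1) =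
      (κ.c₁ * √2 * (P.eig n).stretchAmpA P.Q + κ.c₂ * (P.eig n).fillAmpA P.Q) *
        ((P.node (2 * n + 1) i).a ⬝ᵥ e) := by
  have ho := P.ortho_node (2 * n + 1) i
  rw [κ.incr_even, sgn_two_mul_add_one, sibling_two_mul_add_one,
    show (2 * i + 1) / 2 = i by omega, diff_of_rotated h, diff_terminal h]
  simp only [dotProduct_add, dotProduct_smul, dotProduct_neg, dotProduct_sub, smul_eq_mul, ho.aa,
    ho.ab]
  ring

lemma b_dotProduct_incr_terminal (hn : n + 1 < P.N) :
    (P.node (2 * n + 1) i).b ⬝ᵥ κ.incr (P.diff e) (2 * n + 2) (2 * i) =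
      κ.c₂ * (P.eig (n + 1)).rotAmp * ((P.node (2 * n + 1) i).a ⬝ᵥ e) -
        κ.c₁ * √2 * (P.eig n).stretchAmpB P.Q * ((P.node (2 * n + 1) i).b ⬝ᵥ e) := by
  have ho := P.ortho_node (2 * n + 1) i
  rw [κ.incr_even, sgn_two_mul, sibling_two_mul, Nat.mul_div_cancel_left i two_pos,
    diff_of_rotated h, diff_stopping h hn]
  simp only [dotProduct_add, dotProduct_smul, dotProduct_sub, smul_eq_mul, ho.bb, ho.ba]
  ring

end

end Params

/-! ### Sums over the tree -/

/-- The positions `i` such that the dyadic interval `(2n+1, i)` is a child of a stopping interval of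
generation `n`. -/
def rotPos : ℕ → Finset ℕ
  | 0 => {0, 1}
  | n + 1 => (rotPos n).image (4 * · + 2) ∪ (rotPos n).image (4 * · + 3)

lemma sum_rotPos_succ {M : Type*} [AddCommMonoid M] (n : ℕ) (Φ : ℕ → M) :
    ∑ i ∈ rotPos (n + 1), Φ i = ∑ i ∈ rotPos n, (Φ (4 * i + 2) + Φ (4 * i + 3)) := by
  rw [rotPos, Finset.sum_union, Finset.sum_image, Finset.sum_image, Finset.sum_add_distrib]
  · intro i _ j _ hij; dsimp only at hij; omega
  · intro i _ j _ hij; dsimp only at hij; omega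
  · simp only [Finset.disjoint_left, Finset.mem_image]
    rintro _ ⟨i, -, rfl⟩ ⟨j, -, hij⟩
    omega

lemma card_rotPos (n : ℕ) : (rotPos n).card = 2 ^ (n + 1) := by
  induction n with
  | zero => rfl
  | succ n ih => rw [Finset.card_eq_sum_ones, sum_rotPos_succ, Finset.sum_const, ih]; rfl

lemma mem_rotPos_succ {n i : ℕ} :
    i ∈ rotPos (n + 1) ↔ ∃ l ∈ rotPos n, i = 4 * l + 2 ∨ i = 4 * l + 3 := by
  simp only [rotPos, Finset.mem_union, Finset.mem_image, eq_comm (a := i), and_or_left, exists_or]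

lemma lt_of_mem_rotPos {n i : ℕ} (hi : i ∈ rotPos n) : i < 2 ^ (2 * n + 1) := by
  induction n generalizing i with
  | zero =>
    rw [rotPos, Finset.mem_insert, Finset.mem_singleton] at hi
    omega
  | succ n ih =>
    obtain ⟨l, hl, hil⟩ := mem_rotPos_succ.1 hi
    have := ih hl
    rw [show 2 * (n + 1) + 1 = 2 * n + 1 + 2 by ring, pow_add]
    omega

namespace Params

variable {P : Params} {n i : ℕ} {e : Fin 2 → ℝ}

lemma node_one_zero (hN : 0 < P.N) : P.node 1 0 =
    ⟨.rotated 0, (P.eig 0).rotate, rotA (-(P.eig 0).delta) P.a₀ P.b₀,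
      rotB (-(P.eig 0).delta) P.a₀ P.b₀⟩ := by
  rw [← neg_one_mul]
  exact child_of_stopping (k := 0) (j := 0) (ε := -1) rfl hN (by norm_num)

lemma node_one_one (hN : 0 < P.N) : P.node 1 1 =
    ⟨.rotated 0, (P.eig 0).rotate, rotA (P.eig 0).delta P.a₀ P.b₀,
      rotB (P.eig 0).delta P.a₀ P.b₀⟩ := by
  rw [← one_mul (P.eig 0).delta]
  exact child_of_stopping (k := 0) (j := 0) (ε := 1) rfl hN (by norm_num)

lemma role_of_mem_rotPos (hn : n < P.N) (hi : i ∈ rotPos n) :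
    (P.node (2 * n + 1) i).role = .rotated n := by
  induction n generalizing i with
  | zero =>
    rw [rotPos, Finset.mem_insert, Finset.mem_singleton] at hi
    rcases hi with rfl | rfl
    · exact congrArg Node.role (node_one_zero hn)
    · exact congrArg Node.role (node_one_one hn)
  | succ n ih =>
    obtain ⟨l, hl, rfl | rfl⟩ := mem_rotPos_succ.1 hi
    · exact congrArg Node.role (rotated_node_left (ih (by omega) hl) hn)
    · exact congrArg Node.role (rotated_node_right (ih (by omega) hl) hn)

lemma rotA_neg_add_rotA (δ : ℝ) (a b : Fin 2 → ℝ) :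
    rotA (-δ) a b + rotA δ a b = (2 * rotCos δ) • a := by
  rw [rotA, rotA, rotCos_neg]; module

lemma rotB_neg_add_rotB (δ : ℝ) (a b : Fin 2 → ℝ) :
    rotB (-δ) a b + rotB δ a b = (2 * rotCos δ) • b := by
  rw [rotB, rotB, rotCos_neg]; module

/-- `2ⁿ` times the product of the cosines of the angles of the first `n` rotations. -/
def cosProd (P : Params) (n : ℕ) : ℝ := ∏ m ∈ Finset.range n, 2 * rotCos (P.eig m).delta

lemma cosProd_succ (P : Params) (n : ℕ) :
    P.cosProd (n + 1) = 2 * rotCos (P.eig n).delta * P.cosProd n :=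
  Finset.prod_range_succ_comm _ n

lemma sum_a_rotPos (hn : n < P.N) :
    ∑ i ∈ rotPos n, (P.node (2 * n + 1) i).a = P.cosProd (n + 1) • P.a₀ := by
  induction n with
  | zero =>
    rw [rotPos, Finset.sum_pair zero_ne_one, node_one_zero hn, node_one_one hn, rotA_neg_add_rotA,
      cosProd, Finset.prod_range_one]
  | succ n ih =>
    rw [sum_rotPos_succ, cosProd_succ, mul_smul, ← ih (by omega), Finset.smul_sum]
    refine Finset.sum_congr rfl fun i hi => ?_
    have hr := role_of_mem_rotPos (P := P) (by omega) hi
    rw [← rotA_neg_add_rotA _ _ (P.node (2 * n + 1) i).b]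
    exact congrArg₂ (· + ·) (congrArg Node.a (rotated_node_left hr hn))
      (congrArg Node.a (rotated_node_right hr hn))

lemma sum_b_rotPos (hn : n < P.N) :
    ∑ i ∈ rotPos n, (P.node (2 * n + 1) i).b = P.cosProd (n + 1) • P.b₀ := by
  induction n with
  | zero =>
    rw [rotPos, Finset.sum_pair zero_ne_one, node_one_zero hn, node_one_one hn, rotB_neg_add_rotB,
      cosProd, Finset.prod_range_one]
  | succ n ih =>
    rw [sum_rotPos_succ, cosProd_succ, mul_smul, ← ih (by omega), Finset.smul_sum]
    refine Finset.sum_congr rfl fun i hi => ?_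
    have hr := role_of_mem_rotPos (P := P) (by omega) hi
    rw [← rotB_neg_add_rotB _ (P.node (2 * n + 1) i).a]
    exact congrArg₂ (· + ·) (congrArg Node.b (rotated_node_left hr hn))
      (congrArg Node.b (rotated_node_right hr hn))

section

variable (κ : ShiftCoeffs)

lemma val_one (j : ℕ) : P.val κ e 1 j = 0 := by
  simp only [val, partialSum, ShiftCoeffs.incr, smul_zero, add_zero]

lemma val_two_mul (k j : ℕ) :
    P.val κ e (k + 1) (2 * j) = P.val κ e k j - κ.incr (P.diff e) k j :=
  partialSum_two_mul _ k j

lemma val_two_mul_add_one (k j : ℕ) :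
    P.val κ e (k + 1) (2 * j + 1) = P.val κ e k j + κ.incr (P.diff e) k j :=
  partialSum_two_mul_add_one _ k j

/-- The average over the children of the stopping intervals of generation `n` of the component
`(b, κ.op f)` of `f = W⁻¹ e`, divided by the product of the cosines of the angles of rotation, for
`(a₀, e) = 1` and `(b₀, e) = v`. -/
def rotDrift (P : Params) (κ : ShiftCoeffs) (v : ℝ) : ℕ → ℝ
  | 0 => 0
  | n + 1 => P.rotDrift κ v n -
      κ.c₃ / √2 * ((P.eig (n + 1)).rotAmp + (P.eig n).fillAmpB P.Q * v) -
      (P.eig (n + 1)).delta *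
        (κ.c₁ * √2 * (P.eig n).stretchAmpA P.Q + κ.c₂ * (P.eig n).fillAmpA P.Q)

/-- The analogue of `rotDrift` for the right halves of the terminal intervals. -/
def terminalDrift (P : Params) (κ : ShiftCoeffs) (v : ℝ) (n : ℕ) : ℝ :=
  P.rotDrift κ v n + ((κ.c₃ / √2 + κ.c₂) * (P.eig (n + 1)).rotAmp +
    (κ.c₃ / √2 * (P.eig n).fillAmpB P.Q - κ.c₁ * √2 * (P.eig n).stretchAmpB P.Q) * v)

lemma b_dotProduct_val_rotated_add (h : (P.node (2 * n + 1) i).role = .rotated n)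
    (hn : n + 1 < P.N) :
    (P.node (2 * n + 3) (4 * i + 2)).b ⬝ᵥ P.val κ e (2 * n + 3) (4 * i + 2) +
      (P.node (2 * n + 3) (4 * i + 3)).b ⬝ᵥ P.val κ e (2 * n + 3) (4 * i + 3) =
    2 * rotCos (P.eig (n + 1)).delta *
      ((P.node (2 * n + 1) i).b ⬝ᵥ P.val κ e (2 * n + 1) i -
        κ.c₃ / √2 * ((P.eig (n + 1)).rotAmp * ((P.node (2 * n + 1) i).a ⬝ᵥ e) +
          (P.eig n).fillAmpB P.Q * ((P.node (2 * n + 1) i).b ⬝ᵥ e)) -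
        (P.eig (n + 1)).delta *
          ((κ.c₁ * √2 * (P.eig n).stretchAmpA P.Q + κ.c₂ * (P.eig n).fillAmpA P.Q) *
            ((P.node (2 * n + 1) i).a ⬝ᵥ e))) := by
  rw [rotated_node_left h hn, rotated_node_right h hn, show 4 * i + 2 = 2 * (2 * i + 1) by ring,
    show 4 * i + 3 = 2 * (2 * i + 1) + 1 by ring, val_two_mul κ (2 * n + 2),
    val_two_mul_add_one κ (2 * n + 2), val_two_mul_add_one κ (2 * n + 1),
    ← a_dotProduct_incr_stopping h κ, sub_eq_add_neg _ (κ.c₃ / √2 * _),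
    ← b_dotProduct_incr_rotated h κ hn]
  simp only [rotB, rotCos_neg, smul_dotProduct, sub_dotProduct, dotProduct_add, dotProduct_sub,
    smul_eq_mul]
  ring

lemma sum_b_dotProduct_val_rotPos (hn : n < P.N) (he : P.a₀ ⬝ᵥ e = 1) :
    ∑ i ∈ rotPos n, (P.node (2 * n + 1) i).b ⬝ᵥ P.val κ e (2 * n + 1) i =
      P.cosProd (n + 1) * P.rotDrift κ (P.b₀ ⬝ᵥ e) n := by
  induction n with
  | zero => simp only [Nat.zero_add, val_one, dotProduct_zero,
      Finset.sum_const_zero, rotDrift, mul_zero]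
  | succ n ih =>
    have ha := congrArg (· ⬝ᵥ e) (sum_a_rotPos (P := P) (n := n) (by omega))
    have hb := congrArg (· ⬝ᵥ e) (sum_b_rotPos (P := P) (n := n) (by omega))
    simp only [sum_dotProduct, smul_dotProduct, smul_eq_mul, he, mul_one] at ha hb
    rw [sum_rotPos_succ]
    refine (Finset.sum_congr rfl fun i hi =>
      b_dotProduct_val_rotated_add κ (role_of_mem_rotPos (by omega) hi) hn).trans ?_
    simp only [← Finset.mul_sum, Finset.sum_sub_distrib, Finset.sum_add_distrib,
      ih (by omega), ha, hb]
    rw [P.cosProd_succ (n + 1), rotDrift]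
    ring

lemma b_dotProduct_val_const (h : (P.node (2 * n + 1) i).role = .rotated n) (hn : n + 1 < P.N) :
    (P.node (2 * n + 3) (4 * i + 1)).b ⬝ᵥ P.val κ e (2 * n + 3) (4 * i + 1) =
      (P.node (2 * n + 1) i).b ⬝ᵥ P.val κ e (2 * n + 1) i +
        ((κ.c₃ / √2 + κ.c₂) * (P.eig (n + 1)).rotAmp * ((P.node (2 * n + 1) i).a ⬝ᵥ e) +
          (κ.c₃ / √2 * (P.eig n).fillAmpB P.Q - κ.c₁ * √2 * (P.eig n).stretchAmpB P.Q) *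
            ((P.node (2 * n + 1) i).b ⬝ᵥ e)) := by
  rw [const_node h, show 4 * i + 1 = 2 * (2 * i) + 1 by ring, val_two_mul_add_one, val_two_mul,
    dotProduct_add, dotProduct_sub, b_dotProduct_incr_rotated h κ hn,
    b_dotProduct_incr_terminal h κ hn]
  ring

lemma sum_b_dotProduct_val_const (hn : n + 1 < P.N) (he : P.a₀ ⬝ᵥ e = 1) :
    ∑ i ∈ rotPos n,
        (P.node (2 * n + 3) (4 * i + 1)).b ⬝ᵥ P.val κ e (2 * n + 3) (4 * i + 1) =
      P.cosProd (n + 1) * P.terminalDrift κ (P.b₀ ⬝ᵥ e) n := by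
  have ha := congrArg (· ⬝ᵥ e) (sum_a_rotPos (P := P) (n := n) (by omega))
  have hb := congrArg (· ⬝ᵥ e) (sum_b_rotPos (P := P) (n := n) (by omega))
  simp only [sum_dotProduct, smul_dotProduct, smul_eq_mul, he, mul_one] at ha hb
  rw [Finset.sum_congr rfl fun i hi =>
    b_dotProduct_val_const κ (role_of_mem_rotPos (by omega) hi) hn]
  simp only [← Finset.mul_sum, Finset.sum_add_distrib, ha, hb,
    sum_b_dotProduct_val_rotPos κ (n := n) (by omega) he, terminalDrift]
  ring

end

end Params

/-! ### Size estimates -/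

namespace Eigen.Balanced

variable {Q : ℝ} {σ : Eigen} (h : σ.Balanced Q)

include h

lemma rotate_be_le_sqrt : σ.rotate.be ≤ √(σ.al * σ.be) := by
  refine h.rotate_be_le.trans (Real.le_sqrt_of_sq_le ?_)
  nlinarith [h.be_pos, h.be_le_al]

lemma rotAmp_nonneg : 0 ≤ σ.rotAmp :=
  mul_nonneg (div_nonneg σ.delta_nonneg (by positivity)) (sub_nonneg.2 h.rotate_be_le_al)

lemma rotAmp_le : σ.rotAmp ≤ √(σ.al * σ.be) := by
  have hal : σ.rotate.al ≤ 2 * σ.al := by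
    rw [h.rotate_al]; nlinarith [h.factor_le, h.al_pos]
  have hsin : σ.delta / (1 + σ.delta ^ 2) ≤ σ.delta :=
    div_le_self σ.delta_nonneg (by nlinarith)
  calc σ.rotAmp ≤ σ.delta * (2 * σ.al) :=
        mul_le_mul hsin (by linarith [h.rotate_be_pos]) (sub_nonneg.2 h.rotate_be_le_al)
          σ.delta_nonneg
    _ ≤ √(σ.al * σ.be) := by linarith [h.al_mul_delta, Real.sqrt_nonneg (σ.al * σ.be)]

lemma sqrt_terminalProd_le_one : √(1 - 1 / σ.terminalProd Q) ≤ 1 :=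
  (sqrt_one_sub_one_div_lt_one (one_pos.trans_le h.one_le_terminalProd)).le

lemma fillAmpA_nonneg : 0 ≤ σ.fillAmpA Q := by
  rw [fillAmpA, stretchLeft_al]
  exact mul_nonneg (Real.sqrt_nonneg _) (div_nonneg h.rotate_al_pos.le h.Q_pos.le)

lemma fillAmpA_le : σ.fillAmpA Q ≤ σ.rotate.al / Q := by
  rw [fillAmpA, stretchLeft_al]
  exact mul_le_of_le_one_left (div_nonneg h.rotate_al_pos.le h.Q_pos.le)
    h.sqrt_terminalProd_le_one

lemma stretchLeft_be_nonneg : 0 ≤ (σ.rotate.stretchLeft Q).be :=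
  mul_nonneg (by linarith [h.one_div_s_mul_stretchR_le]) h.rotate_be_pos.le

lemma fillAmpB_nonneg : 0 ≤ σ.fillAmpB Q :=
  mul_nonneg (Real.sqrt_nonneg _) h.stretchLeft_be_nonneg

lemma fillAmpB_le : σ.fillAmpB Q ≤ 2 * √(σ.al * σ.be) :=
  calc σ.fillAmpB Q ≤ (σ.rotate.stretchLeft Q).be :=
        mul_le_of_le_one_left h.stretchLeft_be_nonneg h.sqrt_terminalProd_le_one
    _ ≤ 2 * σ.rotate.be :=
        mul_le_mul_of_nonneg_right (by linarith [h.one_div_s_mul_stretchR_pos])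
          h.rotate_be_pos.le
    _ ≤ 2 * √(σ.al * σ.be) := by linarith [h.rotate_be_le_sqrt]

lemma stretchAmpB_nonpos : σ.stretchAmpB Q ≤ 0 :=
  mul_nonpos_of_nonpos_of_nonneg (by linarith [h.one_div_s_mul_stretchR_le]) h.rotate_be_pos.le

lemma neg_stretchAmpB_le : -σ.stretchAmpB Q ≤ √(σ.al * σ.be) := by
  refine le_trans ?_ h.rotate_be_le_sqrt
  rw [stretchAmpB, ← neg_mul]
  exact mul_le_of_le_one_left h.rotate_be_pos.le (by linarith [h.one_div_s_mul_stretchR_pos])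

end Eigen.Balanced

lemma one_sub_sq_div_two_le_rotCos (δ : ℝ) : 1 - δ ^ 2 / 2 ≤ rotCos δ := by
  have hpos : 0 < √(1 + δ ^ 2) := Real.sqrt_pos.2 (by positivity)
  have hsqrt : √(1 + δ ^ 2) ≤ 1 + δ ^ 2 / 2 := by
    rw [Real.sqrt_le_left (by positivity)]; nlinarith
  rw [rotCos, ← one_div, le_div_iff₀ hpos]
  nlinarith [Real.sq_sqrt (show 0 ≤ 1 + δ ^ 2 by positivity)]

lemma half_le_stretchR_div_two_pow {Q : ℝ} {n : ℕ} (hQ : 2 ≤ Q) (hn : n ≤ Q) :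
    1 / 2 ≤ (stretchR Q / 2) ^ n := by
  have : 0 < Q := by linarith
  have hle : n * (1 / (2 * Q)) ≤ 1 / 2 := by
    rw [mul_one_div, div_le_div_iff₀ (by linarith) two_pos]; linarith
  have hsmall : 1 / (2 * Q) ≤ 2 := by
    rw [div_le_iff₀ (by linarith)]; linarith
  have hbernoulli := one_add_mul_le_pow (neg_le_neg hsmall) n
  rw [show stretchR Q / 2 = 1 + -(1 / (2 * Q)) by rw [stretchR]; field_simp; ring]
  linarith

namespace ShiftCoeffs

/-- A lower bound for the decrease of `Params.rotDrift` from one generation to the next, in units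
of `√(α₀ β₀)`. -/
def rate (κ : ShiftCoeffs) : ℝ := κ.c₁ / 30

/-- A bound for the difference of `Params.terminalDrift` and `Params.rotDrift`, in units of
`√(α₀ β₀)`. -/
def terminalBound (κ : ShiftCoeffs) : ℝ := 2 * κ.c₁ + |κ.c₂| + 3 * κ.c₃

end ShiftCoeffs

namespace Params

variable (P : Params)

lemma two_pow_div_two_le_cosProd (n : ℕ) : 2 ^ n / 2 ≤ P.cosProd n := by
  suffices h : 2 ^ n * (1 / 2 + 1 / 2 * (4 / 9) ^ n) ≤ P.cosProd n by
    have : (0 : ℝ) < 2 ^ n * (4 / 9) ^ n := by positivity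
    linarith
  induction n with
  | zero => norm_num [cosProd]
  | succ n ih =>
    have hcos := one_sub_sq_div_two_le_rotCos (P.eig n).delta
    rw [(P.balanced_eig n).delta_sq] at hcos
    have hratio := P.eig_ratio_le n
    have hx1 : ((4 : ℝ) / 9) ^ n ≤ 1 := pow_le_one₀ (by norm_num) (by norm_num)
    have hx0 : (0 : ℝ) < (4 / 9) ^ n := by positivity
    rw [cosProd_succ, pow_succ, pow_succ]
    set x := ((4 : ℝ) / 9) ^ n
    have hstep : 1 / 2 + 1 / 2 * (x * (4 / 9)) ≤ (1 - x / 200) * (1 / 2 + 1 / 2 * x) := by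
      nlinarith
    calc (2 : ℝ) ^ n * 2 * (1 / 2 + 1 / 2 * (x * (4 / 9)))
        ≤ 2 ^ n * 2 * ((1 - x / 200) * (1 / 2 + 1 / 2 * x)) := by gcongr
      _ = 2 * (1 - x / 200) * (2 ^ n * (1 / 2 + 1 / 2 * x)) := by ring
      _ ≤ 2 * rotCos (P.eig n).delta * P.cosProd n :=
          mul_le_mul (by linarith) ih (by positivity) (by linarith)

lemma delta_succ_mul_rotate_al (n : ℕ) :
    (P.eig (n + 1)).delta * (P.eig n).rotate.al = √(P.α₀ * P.β₀) / (10 * stretchR P.Q) := by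
  have hpos := (P.balanced_eig n).stretchR_pos
  have hδ := (P.balanced_eig (n + 1)).al_mul_delta
  have hal : (P.eig (n + 1)).al = stretchR P.Q * (P.eig n).rotate.al := rfl
  rw [P.eig_al_mul_be, hal] at hδ
  rw [eq_div_iff (by positivity)]
  linarith

section

variable {P} {κ : ShiftCoeffs} {v : ℝ}

lemma rate_mul_sqrt_le (hc₁ : 0 < κ.c₁) (hc₂ : 5 * |κ.c₂| ≤ κ.c₁ * P.Q) (n : ℕ) :
    κ.rate * √(P.α₀ * P.β₀) ≤ (P.eig (n + 1)).delta *
      (κ.c₁ * √2 * (P.eig n).stretchAmpA P.Q + κ.c₂ * (P.eig n).fillAmpA P.Q) := by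
  have hσ := P.balanced_eig n
  have hr := hσ.three_halves_le_stretchR
  have hal := hσ.rotate_al_pos
  have hsqrt : 7 / 5 ≤ √2 := Real.le_sqrt_of_sq_le (by norm_num)
  have hstretch : κ.c₁ * (7 / 5) * ((stretchR P.Q - 1) * (P.eig n).rotate.al) ≤
      κ.c₁ * √2 * (P.eig n).stretchAmpA P.Q :=
    mul_le_mul_of_nonneg_right (by gcongr) (mul_nonneg (by linarith) hal.le)
  have hfill : |κ.c₂ * (P.eig n).fillAmpA P.Q| ≤ κ.c₁ / 5 * (P.eig n).rotate.al := by
    rw [abs_mul, abs_of_nonneg hσ.fillAmpA_nonneg]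
    calc |κ.c₂| * (P.eig n).fillAmpA P.Q ≤ |κ.c₂| * ((P.eig n).rotate.al / P.Q) := by
          gcongr; exact hσ.fillAmpA_le
      _ = |κ.c₂| / P.Q * (P.eig n).rotate.al := by ring
      _ ≤ κ.c₁ / 5 * (P.eig n).rotate.al := by
          refine mul_le_mul_of_nonneg_right ?_ hal.le
          rw [div_le_div_iff₀ P.Q_pos (by norm_num)]
          linarith
  calc κ.rate * √(P.α₀ * P.β₀)
      = (P.eig (n + 1)).delta * (κ.c₁ / 3 * stretchR P.Q * (P.eig n).rotate.al) := by
        have := hσ.stretchR_pos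
        rw [mul_left_comm, P.delta_succ_mul_rotate_al, ShiftCoeffs.rate]
        field_simp
        ring
    _ ≤ _ := by
        refine mul_le_mul_of_nonneg_left ?_ (Eigen.delta_nonneg _)
        have : 0 ≤ κ.c₁ * (P.eig n).rotate.al * (stretchR P.Q - 3 / 2) :=
          mul_nonneg (mul_pos hc₁ hal).le (by linarith)
        linarith [(abs_le.1 hfill).1]

lemma rotDrift_le (hc₁ : 0 < κ.c₁) (hc₂ : 5 * |κ.c₂| ≤ κ.c₁ * P.Q) (hc₃ : 0 ≤ κ.c₃)
    (hv : 0 ≤ v) (n : ℕ) : P.rotDrift κ v n ≤ -(n * (κ.rate * √(P.α₀ * P.β₀))) := by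
  induction n with
  | zero => simp only [rotDrift, Nat.cast_zero, zero_mul, neg_zero, le_refl]
  | succ n ih =>
    have hrate := rate_mul_sqrt_le hc₁ hc₂ n
    have hrot := (P.balanced_eig (n + 1)).rotAmp_nonneg
    have hfill := (P.balanced_eig n).fillAmpB_nonneg
    have : 0 ≤ κ.c₃ / √2 * ((P.eig (n + 1)).rotAmp + (P.eig n).fillAmpB P.Q * v) := by
      positivity
    rw [rotDrift]
    push_cast
    linarith

lemma terminalDrift_le (hc₁ : 0 < κ.c₁) (hc₃ : 0 ≤ κ.c₃) (hv : v ≤ 1) (n : ℕ) :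
    P.terminalDrift κ v n ≤ P.rotDrift κ v n + κ.terminalBound * √(P.α₀ * P.β₀) := by
  have hσ := P.balanced_eig n
  have hσ' := P.balanced_eig (n + 1)
  have hrot := hσ'.rotAmp_le
  have hfill := hσ.fillAmpB_le
  have hstretch := hσ.neg_stretchAmpB_le
  rw [P.eig_al_mul_be] at hrot hfill hstretch
  rw [terminalDrift, ShiftCoeffs.terminalBound]
  set w := √(P.α₀ * P.β₀)
  have hc : κ.c₃ / √2 ≤ κ.c₃ := div_le_self hc₃ (Real.one_le_sqrt.2 (by norm_num))
  have hc0 : 0 ≤ κ.c₃ / √2 := by positivity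
  have hsqrt : √2 ≤ 2 := (Real.sqrt_le_left two_pos.le).2 (by norm_num)
  have hrotTerm : (κ.c₃ / √2 + κ.c₂) * (P.eig (n + 1)).rotAmp ≤ (κ.c₃ + |κ.c₂|) * w :=
    mul_le_mul (add_le_add hc (le_abs_self _)) hrot hσ'.rotAmp_nonneg (by positivity)
  have hfillTerm : κ.c₃ / √2 * (P.eig n).fillAmpB P.Q ≤ κ.c₃ * (2 * w) :=
    mul_le_mul hc hfill hσ.fillAmpB_nonneg hc₃
  have hstretchTerm : κ.c₁ * √2 * -(P.eig n).stretchAmpB P.Q ≤ κ.c₁ * 2 * w :=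
    mul_le_mul (by gcongr) hstretch (neg_nonneg.2 hσ.stretchAmpB_nonpos) (by positivity)
  have hbTerm : (κ.c₃ / √2 * (P.eig n).fillAmpB P.Q -
      κ.c₁ * √2 * (P.eig n).stretchAmpB P.Q) * v ≤ κ.c₃ * (2 * w) + κ.c₁ * 2 * w := by
    refine (mul_le_of_le_one_right ?_ hv).trans (by linarith)
    rw [sub_eq_add_neg, ← mul_neg]
    exact add_nonneg (mul_nonneg hc0 hσ.fillAmpB_nonneg)
      (mul_nonneg (by positivity) (neg_nonneg.2 hσ.stretchAmpB_nonpos))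
  linarith

end

lemma two_pow_div_le_alS {n : ℕ} (hn : n ≤ P.Q) :
    2 ^ n / (2 * P.β₀) ≤ ((P.eig n).rotate.stretchLeft P.Q).alS := by
  have hσ := P.balanced_eig n
  have := P.α₀_pos
  have := P.β₀_pos
  have hpow := half_le_stretchR_div_two_pow P.two_le_Q hn
  rw [div_pow, div_le_div_iff₀ two_pos (by positivity), one_mul] at hpow
  calc 2 ^ n / (2 * P.β₀) = 2 ^ n * P.α₀ / 2 / (P.α₀ * P.β₀) := by field_simp
    _ ≤ (P.eig n).rotate.al / (P.α₀ * P.β₀) := by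
        gcongr
        calc 2 ^ n * P.α₀ / 2 ≤ stretchR P.Q ^ n * P.α₀ := by nlinarith
          _ ≤ (P.eig n).al := P.le_eig_al n
          _ ≤ (P.eig n).rotate.al := by
            rw [hσ.rotate_al]
            exact le_mul_of_one_le_left hσ.al_pos.le hσ.one_le_factor
    _ = ((P.eig n).rotate.stretchLeft P.Q).alS := by rw [hσ.stretchLeft_alS, P.eig_al_mul_be]

end Params

/-! ### The lower bound -/

lemma sum_lintegral_terminal_le (φ : ℝ → ENNReal) (M : ℕ) :
    ∑ n ∈ Finset.range M, ∑ i ∈ rotPos n, ∫⁻ x in dyadic (2 * n + 3) (4 * i + 1), φ x ≤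
      ∫⁻ x in Set.Ico (0 : ℝ) 1, φ x := by
  suffices h :
      ∑ n ∈ Finset.range M, ∑ i ∈ rotPos n, (∫⁻ x in dyadic (2 * n + 3) (4 * i + 1), φ x) +
        ∑ i ∈ rotPos M, ∫⁻ x in dyadic (2 * M + 1) i, φ x ≤ ∫⁻ x in Set.Ico (0 : ℝ) 1, φ x from
    le_self_add.trans h
  induction M with
  | zero =>
    rw [Finset.sum_range_zero, zero_add, rotPos, Finset.sum_pair zero_ne_one, ← dyadic_zero_zero,
      lintegral_dyadic_add φ 0 0]
    exact le_rfl
  | succ M ih =>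
    refine le_trans ?_ ih
    rw [Finset.sum_range_succ, add_assoc, sum_rotPos_succ, ← Finset.sum_add_distrib]
    gcongr with i
    rw [lintegral_dyadic_add φ (2 * M + 1) i, lintegral_dyadic_add φ (2 * M + 2) (2 * i),
      lintegral_dyadic_add φ (2 * M + 2) (2 * i + 1), show 4 * i + 1 = 2 * (2 * i) + 1 by ring,
      show 4 * i + 2 = 2 * (2 * i + 1) by ring, show 4 * i + 3 = 2 * (2 * i + 1) + 1 by ring]
    exact add_le_add le_add_self le_rfl

namespace Params

variable {P : Params} {κ : ShiftCoeffs} {n i : ℕ} {e : Fin 2 → ℝ}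

/-- The squared density `(W Tf, Tf)` for `T = κ.op` and `f = W⁻¹ e`. -/
def density (P : Params) (κ : ShiftCoeffs) (e : Fin 2 → ℝ) (x : ℝ) : ENNReal :=
  ENNReal.ofReal ((P.weight x *ᵥ κ.op (testFun P.weight e) x) ⬝ᵥ κ.op (testFun P.weight e) x)

lemma density_eq_of_const (hi : i < 2 ^ (2 * n + 1)) (h : (P.node (2 * n + 1) i).role = .const)
    {x : ℝ} (hx : x ∈ dyadic (2 * n + 1) i) :
    P.density κ e x = ENNReal.ofReal (((P.node (2 * n + 1) i).avgW *ᵥ P.val κ e (2 * n + 1) i) ⬝ᵥ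
      P.val κ e (2 * n + 1) i) := by
  have hidx := dyadicIdx_of_mem hx
  rw [density, op_testFun_eq_val κ e hi h hx, weight_eq_of_const (k := 2 * n + 1) (by rwa [hidx]),
    hidx]

lemma le_lintegral_density (hi : i ∈ rotPos n) (hn : n < P.N) :
    ENNReal.ofReal (((P.eig n).rotate.stretchLeft P.Q).alS * (2 ^ (2 * n + 3))⁻¹ *
      ((P.node (2 * n + 3) (4 * i + 1)).b ⬝ᵥ P.val κ e (2 * n + 3) (4 * i + 1)) ^ 2) ≤
      ∫⁻ x in dyadic (2 * n + 3) (4 * i + 1), P.density κ e x := by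
  have hnode := const_node (P := P) (role_of_mem_rotPos hn hi)
  have hconst : (P.node (2 * n + 3) (4 * i + 1)).role = .const := by rw [hnode]
  have hlt : 4 * i + 1 < 2 ^ (2 * (n + 1) + 1) := by
    have := lt_of_mem_rotPos hi
    rw [show 2 * (n + 1) + 1 = 2 * n + 1 + 2 by ring, pow_add]
    omega
  have hfill := (P.balanced_eig n).fillable_stretchLeft
  have hsat := hfill.saturated_fill (ε := 1) abs_one
  have heig : (P.node (2 * n + 3) (4 * i + 1)).eig =
      ((P.eig n).rotate.stretchLeft P.Q).fill 1 := by rw [hnode]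
  have halS : ((P.eig n).rotate.stretchLeft P.Q).alS ≤
      (((P.eig n).rotate.stretchLeft P.Q).fill 1).alS := by
    refine le_mul_of_one_le_right hfill.alS_pos.le ?_
    rw [one_mul]
    exact le_add_of_nonneg_right (Real.sqrt_nonneg _)
  have hint : ∫⁻ x in dyadic (2 * n + 3) (4 * i + 1), P.density κ e x =
      ENNReal.ofReal (((P.node (2 * n + 3) (4 * i + 1)).avgW *ᵥ
        P.val κ e (2 * n + 3) (4 * i + 1)) ⬝ᵥ P.val κ e (2 * n + 3) (4 * i + 1)) *
        ENNReal.ofReal (2 ^ (2 * n + 3))⁻¹ :=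
    lintegral_dyadic_of_eqOn fun x hx => density_eq_of_const hlt hconst hx
  rw [hint, ← ENNReal.ofReal_mul' (by positivity)]
  refine ENNReal.ofReal_le_ofReal ?_
  rw [avgW_mulVec_dotProduct, mul_right_comm]
  refine mul_le_mul_of_nonneg_right ?_ (by positivity)
  rw [heig]
  exact le_add_of_nonneg_of_le (mul_nonneg hsat.beS_pos.le (sq_nonneg _))
    (mul_le_mul_of_nonneg_right halS (sq_nonneg _))

section

variable (hc₁ : 0 < κ.c₁) (hc₂ : 5 * |κ.c₂| ≤ κ.c₁ * P.Q) (hc₃ : 0 ≤ κ.c₃)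
  (he : P.a₀ ⬝ᵥ e = 1) (hv : 0 ≤ P.b₀ ⬝ᵥ e) (hv1 : P.b₀ ⬝ᵥ e ≤ 1)

include hc₁ hc₂ hc₃ he hv hv1

lemma le_sum_b_dotProduct_val_sq (hn : n + 1 < P.N) (hnκ : 2 * κ.terminalBound ≤ n * κ.rate) :
    2 ^ n * (n * κ.rate) ^ 2 * (P.α₀ * P.β₀) / 8 ≤ ∑ i ∈ rotPos n,
      ((P.node (2 * n + 3) (4 * i + 1)).b ⬝ᵥ P.val κ e (2 * n + 3) (4 * i + 1)) ^ 2 := by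
  have hα := P.α₀_pos
  have hβ := P.β₀_pos
  have hrate : 0 < κ.rate := div_pos hc₁ (by norm_num)
  have hcos := P.two_pow_div_two_le_cosProd (n + 1)
  have hrot := rotDrift_le hc₁ hc₂ hc₃ hv n
  have hterm := terminalDrift_le (P := P) hc₁ hc₃ hv1 n
  have hcs := sq_sum_le_card_mul_sum_sq (s := rotPos n) (f := fun i =>
    (P.node (2 * n + 3) (4 * i + 1)).b ⬝ᵥ P.val κ e (2 * n + 3) (4 * i + 1))
  rw [sum_b_dotProduct_val_const κ hn he, card_rotPos] at hcs
  set w := √(P.α₀ * P.β₀) with hw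
  set S := ∑ i ∈ rotPos n,
    ((P.node (2 * n + 3) (4 * i + 1)).b ⬝ᵥ P.val κ e (2 * n + 3) (4 * i + 1)) ^ 2
  have hdrift : n * κ.rate * w / 2 ≤ -P.terminalDrift κ (P.b₀ ⬝ᵥ e) n := by
    have := mul_le_mul_of_nonneg_right hnκ (Real.sqrt_nonneg (P.α₀ * P.β₀))
    linarith
  have hmul : 2 ^ n * (n * κ.rate * w / 2) ≤
      P.cosProd (n + 1) * -P.terminalDrift κ (P.b₀ ⬝ᵥ e) n := by
    rw [pow_succ, mul_div_cancel_right₀ _ two_ne_zero] at hcos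
    exact mul_le_mul hcos hdrift (by positivity) (le_trans (by positivity) hcos)
  have hsq : (2 ^ n * (n * κ.rate * w / 2)) ^ 2 ≤ 2 ^ (n + 1) * S := by
    refine (pow_le_pow_left₀ (by positivity) hmul 2).trans ?_
    rw [mul_neg, neg_sq]
    exact_mod_cast hcs
  refine le_of_mul_le_mul_left ?_ (show (0 : ℝ) < 2 ^ (n + 1) by positivity)
  calc 2 ^ (n + 1) * (2 ^ n * (n * κ.rate) ^ 2 * (P.α₀ * P.β₀) / 8)
      = (2 ^ n * (n * κ.rate * w / 2)) ^ 2 := by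
        rw [← Real.sq_sqrt (show 0 ≤ P.α₀ * P.β₀ by positivity), ← hw]; ring
    _ ≤ 2 ^ (n + 1) * S := hsq

lemma le_sum_lintegral_density (hn : n + 1 < P.N) (hnQ : n ≤ P.Q)
    (hnκ : 2 * κ.terminalBound ≤ n * κ.rate) :
    ENNReal.ofReal (P.α₀ * n ^ 2 * κ.rate ^ 2 / 128) ≤
      ∑ i ∈ rotPos n, ∫⁻ x in dyadic (2 * n + 3) (4 * i + 1), P.density κ e x := by
  have hα := P.α₀_pos
  have hβ := P.β₀_pos
  have hpos := (P.balanced_eig n).fillable_stretchLeft.alS_pos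
  refine le_trans ?_ (Finset.sum_le_sum fun i hi => le_lintegral_density hi (by omega))
  rw [← ENNReal.ofReal_sum_of_nonneg fun i _ => by positivity, ← Finset.mul_sum]
  refine ENNReal.ofReal_le_ofReal ?_
  calc P.α₀ * n ^ 2 * κ.rate ^ 2 / 128
      = 2 ^ n / (2 * P.β₀) * (2 ^ (2 * n + 3))⁻¹ *
          (2 ^ n * (n * κ.rate) ^ 2 * (P.α₀ * P.β₀) / 8) := by
        rw [pow_add, two_mul n, pow_add]
        field_simp
        ring
    _ ≤ _ := mul_le_mul (by gcongr; exact P.two_pow_div_le_alS hnQ)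
        (le_sum_b_dotProduct_val_sq hc₁ hc₂ hc₃ he hv hv1 hn hnκ) (by positivity) (by positivity)

lemma le_lintegral_density_Ico (hQ : 8 ≤ P.Q) (hN : P.Q + 1 ≤ P.N)
    (hQκ : 4 * κ.terminalBound ≤ P.Q * κ.rate) :
    ENNReal.ofReal (P.α₀ * P.Q ^ 3 * κ.rate ^ 2 / 2048) ≤
      ∫⁻ x in Set.Ico (0 : ℝ) 1, P.density κ e x := by
  have hα := P.α₀_pos
  have hrate : 0 < κ.rate := div_pos hc₁ (by norm_num)
  have hfloor : (⌊P.Q⌋₊ : ℝ) ≤ P.Q := Nat.floor_le P.Q_pos.le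
  have hterm : ∀ n ∈ Finset.Ico ⌈P.Q / 2⌉₊ ⌊P.Q⌋₊,
      ENNReal.ofReal (P.α₀ * (P.Q / 2) ^ 2 * κ.rate ^ 2 / 128) ≤
        ∑ i ∈ rotPos n, ∫⁻ x in dyadic (2 * n + 3) (4 * i + 1), P.density κ e x := by
    intro n hn
    rw [Finset.mem_Ico, Nat.ceil_le] at hn
    have hlt : ((n + 1 : ℕ) : ℝ) ≤ ⌊P.Q⌋₊ := Nat.cast_le.2 hn.2
    push_cast at hlt
    have hnN : n + 1 < P.N := by
      rw [← Nat.cast_lt (α := ℝ)]; push_cast; linarith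
    have := P.Q_pos
    have := mul_le_mul_of_nonneg_right hn.1 hrate.le
    refine (ENNReal.ofReal_le_ofReal ?_).trans
      (le_sum_lintegral_density hc₁ hc₂ hc₃ he hv hv1 hnN (by linarith) (by linarith))
    gcongr
    exact hn.1
  have hcard : P.Q / 4 ≤ ((⌊P.Q⌋₊ - ⌈P.Q / 2⌉₊ : ℕ) : ℝ) := by
    have := Nat.lt_floor_add_one P.Q
    have := Nat.ceil_lt_add_one (show 0 ≤ P.Q / 2 by linarith)
    have := Nat.sub_le_iff_le_add.1 (le_refl (⌊P.Q⌋₊ - ⌈P.Q / 2⌉₊))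
    have : (⌊P.Q⌋₊ : ℝ) ≤ (⌊P.Q⌋₊ - ⌈P.Q / 2⌉₊ : ℕ) + ⌈P.Q / 2⌉₊ := by exact_mod_cast this
    linarith
  calc ENNReal.ofReal (P.α₀ * P.Q ^ 3 * κ.rate ^ 2 / 2048)
      = ENNReal.ofReal (P.Q / 4 * (P.α₀ * (P.Q / 2) ^ 2 * κ.rate ^ 2 / 128)) := by
        congr 1; ring
    _ ≤ (Finset.Ico ⌈P.Q / 2⌉₊ ⌊P.Q⌋₊).card •
          ENNReal.ofReal (P.α₀ * (P.Q / 2) ^ 2 * κ.rate ^ 2 / 128) := by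
        rw [Nat.card_Ico, nsmul_eq_mul, ← ENNReal.ofReal_natCast,
          ← ENNReal.ofReal_mul (by positivity)]
        gcongr
    _ ≤ ∑ n ∈ Finset.Ico ⌈P.Q / 2⌉₊ ⌊P.Q⌋₊, ∑ i ∈ rotPos n,
          ∫⁻ x in dyadic (2 * n + 3) (4 * i + 1), P.density κ e x :=
        Finset.card_nsmul_le_sum _ _ _ hterm
    _ ≤ ∑ n ∈ Finset.range ⌊P.Q⌋₊, ∑ i ∈ rotPos n,
          ∫⁻ x in dyadic (2 * n + 3) (4 * i + 1), P.density κ e x :=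
        Finset.sum_le_sum_of_subset fun n hn => Finset.mem_range.2 (Finset.mem_Ico.1 hn).2
    _ ≤ ∫⁻ x in Set.Ico (0 : ℝ) 1, P.density κ e x := sum_lintegral_terminal_le _ _

lemma mul_weightedNorm_testFun_le (hQ : 8 ≤ P.Q) (hN : P.Q + 1 ≤ P.N)
    (hQκ : 4 * κ.terminalBound ≤ P.Q * κ.rate) :
    ENNReal.ofReal (κ.rate / 64 * P.Q ^ (3 / 2 : ℝ)) *
        weightedNorm P.weight (testFun P.weight e) ≤
      weightedNorm P.weight (κ.op (testFun P.weight e)) := by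
  have hα := P.α₀_pos
  have := P.β₀_pos
  have hQ0 := P.Q_pos
  have hrate : 0 < κ.rate := div_pos hc₁ (by norm_num)
  have hconst : κ.rate / 64 * P.Q ^ (3 / 2 : ℝ) =
      ((κ.rate / 64) ^ 2 * P.Q ^ 3) ^ (1 / 2 : ℝ) := by
    rw [Real.mul_rpow (by positivity) (by positivity), ← Real.sqrt_eq_rpow,
      Real.sqrt_sq (by positivity), ← Real.rpow_natCast, ← Real.rpow_mul hQ0.le]
    norm_num
  have hnorm : P.α₀ * (P.a₀ ⬝ᵥ e) ^ 2 + P.β₀ * (P.b₀ ⬝ᵥ e) ^ 2 ≤ 2 * P.α₀ := by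
    rw [he]
    nlinarith [P.β₀_le_α₀, pow_le_one₀ (n := 2) hv hv1]
  rw [P.weightedNorm_testFun, hconst,
    ← ENNReal.ofReal_rpow_of_nonneg (by positivity) (by norm_num),
    ← ENNReal.mul_rpow_of_nonneg _ _ (by norm_num), weightedNorm,
    ← ENNReal.ofReal_mul (by positivity)]
  refine ENNReal.rpow_le_rpow (le_trans (ENNReal.ofReal_le_ofReal ?_)
    (le_lintegral_density_Ico hc₁ hc₂ hc₃ he hv hv1 hQ hN hQκ)) (by norm_num)
  calc _ ≤ (κ.rate / 64) ^ 2 * P.Q ^ 3 * (2 * P.α₀) := by gcongr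
    _ = P.α₀ * P.Q ^ 3 * κ.rate ^ 2 / 2048 := by ring

end

end Params

lemma ShiftCoeffs.lowerBound_op {κ : ShiftCoeffs} (hc₁ : 0 < κ.c₁) (hc₃ : 0 ≤ κ.c₃) :
    LowerBound κ.op := by
  have hrate : 0 < κ.rate := div_pos hc₁ (by norm_num)
  have hbound : 0 ≤ κ.terminalBound := by rw [terminalBound]; positivity
  refine ⟨κ.rate / 64, by positivity, 8 + 5 * |κ.c₂| / κ.c₁ + 4 * κ.terminalBound / κ.rate,
    fun Q hQ => ⟨1 / 10, by norm_num, fun α₀ β₀ hα hβ hδ => ⟨⌈Q⌉₊ + 1,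
      fun N hN a₀ b₀ e haa hbb hab he => ?_⟩⟩⟩
  have : 0 ≤ 5 * |κ.c₂| / κ.c₁ := by positivity
  have : 0 ≤ 4 * κ.terminalBound / κ.rate := by positivity
  have hβα : β₀ ≤ α₀ := by
    have h : √(β₀ / α₀) ≤ 1 := by linarith
    rwa [Real.sqrt_le_one, div_le_one hα] at h
  have ho : OrthoPair a₀ b₀ := ⟨haa, hbb, hab⟩
  have hNQ : Q + 1 ≤ N := by
    have h : ((⌈Q⌉₊ + 1 : ℕ) : ℝ) ≤ N := Nat.cast_le.2 hN
    push_cast at h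
    linarith [Nat.le_ceil Q]
  let P : Params := ⟨Q, α₀, β₀, a₀, b₀, N, by linarith, hβ, hβα, ho⟩
  have hae : a₀ ⬝ᵥ e = 1 := by
    rcases he with rfl | rfl <;> simp only [dotProduct_add, haa, hab, add_zero]
  have hbe : 0 ≤ b₀ ⬝ᵥ e ∧ b₀ ⬝ᵥ e ≤ 1 := by
    rcases he with rfl | rfl <;> simp only [dotProduct_add, ho.ba, hbb] <;> norm_num
  refine P.mul_weightedNorm_testFun_le hc₁ ?_ hc₃ hae hbe.1 hbe.2 (by linarith) hNQ ?_
  · rw [mul_comm κ.c₁, ← div_le_iff₀ hc₁]; linarith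
  · rw [← div_le_iff₀ hrate]; linarith

lemma LowerBound.of_eq_neg {T T' : (ℝ → Fin 2 → ℝ) → ℝ → Fin 2 → ℝ} (h : LowerBound T)
    (hT : ∀ f x, T' f x = -T f x) : LowerBound T' := by
  have hnorm : ∀ W f, weightedNorm W (T' f) = weightedNorm W (T f) := fun W f => by
    simp only [weightedNorm, hT, Matrix.mulVec_neg, neg_dotProduct_neg]
  simpa only [LowerBound, hnorm] using h

end DyadicModel

end

theorem lemma5p1_general {c₁ c₃ : ℝ} (c₂ : ℝ) (hc₁ : c₁ ≠ 0) (hc₁₃ : 0 ≤ c₁ * c₃) :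
    DyadicModel.LowerBound fun f x => c₁ • DyadicModel.oddShift f x -
      c₃ • DyadicModel.oddShiftAdj f x + c₂ • DyadicModel.oddShiftZero f x := by
  rcases hc₁.lt_or_gt with hneg | hpos
  · refine (DyadicModel.ShiftCoeffs.lowerBound_op (κ := ⟨-c₁, -c₂, -c₃⟩) (neg_pos.2 hneg)
      (neg_nonneg.2 (nonpos_of_mul_nonneg_right hc₁₃ hneg))).of_eq_neg fun f x => ?_
    simp only [DyadicModel.ShiftCoeffs.op]
    module
  · exact DyadicModel.ShiftCoeffs.lowerBound_op (κ := ⟨c₁, c₂, c₃⟩) hpos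
      (nonneg_of_mul_nonneg_right hc₁₃ hpos)

theorem lemma5p1 :
    (∀ c₁ c₂ : ℝ, c₁ ≠ 0 → DyadicModel.LowerBound (DyadicModel.modelOp c₁ c₂)) ∧
      DyadicModel.LowerBound DyadicModel.oddShift := by
  refine ⟨fun c₁ c₂ hc₁ => ?_, ?_⟩
  · simpa only [← smul_sub] using! lemma5p1_general c₂ hc₁ (mul_self_nonneg c₁)
  · simpa using lemma5p1_general 0 one_ne_zero (mul_zero (1 : ℝ)).ge
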